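/- Let $(X,\Sigma)$ be a measurable space and let $p(x,E)$, $x\in X$, $E\in\Sigma$, be a Markov transition function: $p(x,\cdot)$ is a countably additive probability measure for every $x$, and $p(\cdot,E)$ is $\Sigma$-measurable for every $E$. Let $p^k$ be the $k$-step transition function, and $q_m=\frac1m\sum_{k=1}^m p^k$. Let $ba(X,\Sigma)$ be the space of bounded finitely additive real measures on $\Sigma$ with the total variation norm, $ca(X,\Sigma)$ its subspace of countably additive measures, and let $A$ be the Markov operator $$A\mu(E)=\int_X p(x,E)\,\mu(dx),\qquad E\in\Sigma,$$ on $ba(X,\Sigma)$, which maps $ca(X,\Sigma)$ into itself. Put $$\Delta_{ba}=\{\mu\in ba(X,\Sigma):\mu\ge 0,\ \|\mu\|=1,\ A\mu=\mu\},\qquad \Delta_{ca}=\Delta_{ba}\cap ca(X,\Sigma),$$ and let $\dim\Delta_{ba}$ be the algebraic dimension of the linear span of $\Delta_{ba}$. **Theorem 5.3.** If $\dim\Delta_{ba}=1$, then the following conditions hold. * $(D)$: there are $\varphi\in ca(X,\Sigma)$ with $\varphi\ge 0$, $\varepsilon>0$ and an integer $k\ge 1$ such that, for every $E\in\Sigma$,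 $\varphi(E)\le\varepsilon$ implies $p^k(x,E)\le 1-\varepsilon$ for all $x\in X$. * $(\tilde D)$: there are $\varphi\in ca(X,\Sigma)$ with $\varphi\ge 0$, $\varepsilon>0$ and an integer $m\ge 1$ such that, for every $E\in\Sigma$, $\varphi(E)<\varepsilon$ implies $q_m(x,E)\le 1-\varepsilon$ for all $x\in X$. * $(K)$ (the chain is quasicompact): there are a compact linear operator $A_1$ on $ca(X,\Sigma)$ and an integer $k\ge 1$ such that $\|A^k-A_1\|<1$, where $A$ is considered on $ca(X,\Sigma)$. Moreover, $\Delta_{ba}=\Delta_{ca}=\{\mu\}$ for a single countably additive measure $\mu$; in particular the condition $(*)$: $\Delta_{ba}\subset ca(X,\Sigma)$ holds. -/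

import Mathlib

open MeasureTheory ProbabilityTheory Filter Topology

namespace MarkovCharge

/-! ### Bounded finitely additive measures -/

/-- The linear space of bounded finitely additive real set functions on the σ-algebra of `X`.
As for `MeasureTheory.VectorMeasure`, a set function on the σ-algebra is represented by its
extension by `0` to the non-measurable sets. -/
def baSubmodule (X : Type*) [MeasurableSpace X] : Submodule ℝ (Set X → ℝ) where
  carrier := {μ | (∀ E, ¬ MeasurableSet E → μ E = 0) ∧ μ ∅ = 0 ∧
    (∀ E F, MeasurableSet E → MeasurableSet F → Disjoint E F → μ (E ∪ F) = μ E + μ F) ∧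
    ∃ C : ℝ, ∀ E, |μ E| ≤ C}
  add_mem' := by
    rintro μ ν ⟨h1, h2, h3, C, hC⟩ ⟨k1, k2, k3, D, hD⟩
    refine ⟨fun E hE => by simp [h1 E hE, k1 E hE], by simp [h2, k2],
      fun E F hE hF hd => ?_, C + D, fun E => ?_⟩
    · simp only [Pi.add_apply, h3 E F hE hF hd, k3 E F hE hF hd]; ring
    · exact (abs_add_le _ _).trans (add_le_add (hC E) (hD E))
  zero_mem' := ⟨fun _ _ => rfl, rfl, fun _ _ _ _ _ => by simp, 0, fun _ => by simp⟩
  smul_mem' := by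
    rintro c μ ⟨h1, h2, h3, C, hC⟩
    refine ⟨fun E hE => by simp [h1 E hE], by simp [h2], fun E F hE hF hd => ?_,
      |c| * C, fun E => ?_⟩
    · simp only [Pi.smul_apply, smul_eq_mul, h3 E F hE hF hd]; ring
    · simp only [Pi.smul_apply, smul_eq_mul, abs_mul]
      exact mul_le_mul_of_nonneg_left (hC E) (abs_nonneg c)

/-- `ba(X, Σ)`: the space of bounded finitely additive real measures. -/
def Ba (X : Type*) [MeasurableSpace X] : Type _ := ↥(baSubmodule X)

section

variable {X : Type*} [MeasurableSpace X]

noncomputable instance : AddCommGroup (Ba X) := inferInstanceAs (AddCommGroup ↥(baSubmodule X))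

noncomputable instance : Module ℝ (Ba X) := inferInstanceAs (Module ℝ ↥(baSubmodule X))

instance : FunLike (Ba X) (Set X) ℝ where
  coe μ := Subtype.val (p := fun f => f ∈ baSubmodule X) μ
  coe_injective _ _ h := Subtype.ext h

/-- The element of `ba(X, Σ)` given by a bounded finitely additive set function. -/
def Ba.mk (f : Set X → ℝ) (hf : f ∈ baSubmodule X) : Ba X := ⟨f, hf⟩

theorem Ba.mk_apply (f : Set X → ℝ) (hf : f ∈ baSubmodule X) (E : Set X) : Ba.mk f hf E = f E :=
  rfl

theorem Ba.mem (μ : Ba X) : (μ : Set X → ℝ) ∈ baSubmodule X := Subtype.property μ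

theorem Ba.not_measurable (μ : Ba X) {E : Set X} (hE : ¬ MeasurableSet E) : μ E = 0 :=
  μ.mem.1 E hE

theorem Ba.ext {μ ν : Ba X} (h : ∀ E, MeasurableSet E → μ E = ν E) : μ = ν := by
  refine DFunLike.ext _ _ fun E => ?_
  by_cases hE : MeasurableSet E
  · exact h E hE
  · rw [μ.not_measurable hE, ν.not_measurable hE]

theorem Ba.add_apply (μ ν : Ba X) (E : Set X) : (μ + ν) E = μ E + ν E := rfl

theorem Ba.sub_apply (μ ν : Ba X) (E : Set X) : (μ - ν) E = μ E - ν E := rfl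

theorem Ba.smul_apply (c : ℝ) (μ : Ba X) (E : Set X) : (c • μ) E = c * μ E := rfl

theorem Ba.zero_apply (E : Set X) : (0 : Ba X) E = 0 := rfl

theorem Ba.empty (μ : Ba X) : μ ∅ = 0 := μ.mem.2.1

theorem Ba.union (μ : Ba X) {E F : Set X} (hE : MeasurableSet E) (hF : MeasurableSet F)
    (h : Disjoint E F) : μ (E ∪ F) = μ E + μ F := μ.mem.2.2.1 E F hE hF h

theorem Ba.biUnion (μ : Ba X) {ι : Type*} (s : Finset ι) (E : ι → Set X)
    (hE : ∀ i ∈ s, MeasurableSet (E i)) (hd : (s : Set ι).PairwiseDisjoint E) :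
    μ (⋃ i ∈ s, E i) = ∑ i ∈ s, μ (E i) := by
  classical
  induction s using Finset.induction_on with
  | empty => simp [Ba.empty]
  | insert a s ha ih =>
    have hd' : (s : Set ι).PairwiseDisjoint E := hd.subset (by simp)
    rw [Finset.sum_insert ha, Finset.set_biUnion_insert, Ba.union, ih
      (fun i hi => hE i (Finset.mem_insert_of_mem hi)) hd']
    · exact hE a (Finset.mem_insert_self _ _)
    · exact Finset.measurableSet_biUnion _ fun i hi => hE i (Finset.mem_insert_of_mem hi)
    · refine Set.disjoint_iUnion₂_right.2 fun i hi => hd (by simp) (by simp [hi]) ?_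
      rintro rfl
      exact ha hi

/-! ### The total variation norm -/

/-- The sums `∑ |μ(Eᵢ)|` over finite families of pairwise disjoint measurable sets. -/
def variationSums (μ : Ba X) : Set ℝ :=
  {v | ∃ P : Finset (Set X), (∀ E ∈ P, MeasurableSet E) ∧
    (P : Set (Set X)).PairwiseDisjoint id ∧ v = ∑ E ∈ P, |μ E|}

/-- The norm on `ba(X, Σ)` is the total variation. -/
noncomputable instance : Norm (Ba X) := ⟨fun μ => sSup (variationSums μ)⟩

theorem Ba.norm_def (μ : Ba X) : ‖μ‖ = sSup (variationSums μ) := rfl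

theorem variationSums_nonempty (μ : Ba X) : (variationSums μ).Nonempty :=
  ⟨0, ∅, by simp, by simp, by simp⟩

theorem sum_abs_le (μ : Ba X) {C : ℝ} (hC : ∀ E, MeasurableSet E → |μ E| ≤ C)
    {v : ℝ} (hv : v ∈ variationSums μ) : v ≤ 2 * C := by
  obtain ⟨P, hP, hd, rfl⟩ := hv
  have key : ∀ (Q : Finset (Set X)), Q ⊆ P → |∑ E ∈ Q, μ E| ≤ C := by
    intro Q hQ
    have := μ.biUnion Q id (fun i hi => hP i (hQ hi)) (hd.subset (by exact_mod_cast hQ))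
    simp only [id] at this
    rw [← this]
    exact hC _ (Finset.measurableSet_biUnion _ fun i hi => hP i (hQ hi))
  rw [← Finset.sum_filter_add_sum_filter_not P (fun E => 0 ≤ μ E)]
  have h1 := key (P.filter fun E => 0 ≤ μ E) (Finset.filter_subset _ _)
  have h2 := key (P.filter fun E => ¬ 0 ≤ μ E) (Finset.filter_subset _ _)
  have e1 : ∑ E ∈ P with 0 ≤ μ E, |μ E| = ∑ E ∈ P with 0 ≤ μ E, μ E :=
    Finset.sum_congr rfl fun E hE => abs_of_nonneg (Finset.mem_filter.1 hE).2
  have e2 : ∑ E ∈ P with ¬ 0 ≤ μ E, |μ E| = - ∑ E ∈ P with ¬ 0 ≤ μ E, μ E := by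
    rw [← Finset.sum_neg_distrib]
    exact Finset.sum_congr rfl fun E hE => abs_of_neg (not_le.1 (Finset.mem_filter.1 hE).2)
  rw [e1, e2]
  linarith [(abs_le.1 h1).2, (abs_le.1 h2).1]

theorem variationSums_bddAbove (μ : Ba X) : BddAbove (variationSums μ) := by
  obtain ⟨C, hC⟩ := μ.mem.2.2.2
  exact ⟨2 * C, fun v hv => sum_abs_le μ (fun E _ => hC E) hv⟩

theorem Ba.norm_le_two_mul (μ : Ba X) {C : ℝ} (hC : ∀ E, MeasurableSet E → |μ E| ≤ C) :
    ‖μ‖ ≤ 2 * C :=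
  csSup_le (variationSums_nonempty μ) fun _ hv => sum_abs_le μ hC hv

theorem Ba.sum_abs_le_norm (μ : Ba X) {ι : Type*} (s : Finset ι) (E : ι → Set X)
    (hE : ∀ i ∈ s, MeasurableSet (E i)) (hd : (s : Set ι).PairwiseDisjoint E) :
    ∑ i ∈ s, |μ (E i)| ≤ ‖μ‖ := by
  classical
  refine le_csSup (variationSums_bddAbove μ) ⟨s.image E, ?_, ?_, ?_⟩
  · intro F hF
    obtain ⟨i, hi, rfl⟩ := Finset.mem_image.1 hF
    exact hE i hi
  · intro F hF G hG hFG
    obtain ⟨i, hi, rfl⟩ := Finset.mem_image.1 (Finset.mem_coe.1 hF)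
    obtain ⟨j, hj, rfl⟩ := Finset.mem_image.1 (Finset.mem_coe.1 hG)
    exact hd hi hj fun h => hFG (by rw [h])
  · refine (Finset.sum_image_of_pairwise_eq_zero (f := E) (g := fun F => |μ F|) ?_).symm
    intro i hi j hj hij hEq
    have := hd hi hj hij
    simp only [Function.onFun] at this
    rw [← hEq, disjoint_self] at this
    rw [this]
    simpa using μ.empty

theorem Ba.abs_apply_le_norm (μ : Ba X) {E : Set X} (hE : MeasurableSet E) : |μ E| ≤ ‖μ‖ := by
  simpa using μ.sum_abs_le_norm {()} (fun _ => E) (fun _ _ => hE) (by simp)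

theorem Ba.normedSpaceCore : NormedSpace.Core ℝ (Ba X) := by
  have h0 : ∀ μ : Ba X, 0 ≤ ‖μ‖ := fun μ =>
    (abs_nonneg _).trans (μ.abs_apply_le_norm MeasurableSet.empty)
  have hle : ∀ (c : ℝ) (μ : Ba X), ‖c • μ‖ ≤ |c| * ‖μ‖ := by
    intro c μ
    refine csSup_le (variationSums_nonempty _) ?_
    rintro v ⟨P, hP, hd, rfl⟩
    simp only [Ba.smul_apply, abs_mul, ← Finset.mul_sum]
    exact mul_le_mul_of_nonneg_left
      (le_csSup (variationSums_bddAbove μ) ⟨P, hP, hd, rfl⟩) (abs_nonneg c)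
  refine { norm_nonneg := h0, norm_smul := fun c μ => ?_, norm_triangle := fun μ ν => ?_,
           norm_eq_zero_iff := fun μ => ⟨fun h => ?_, ?_⟩ }
  · refine le_antisymm (hle c μ) ?_
    rcases eq_or_ne c 0 with rfl | hc
    · simpa using h0 _
    · have := hle c⁻¹ (c • μ)
      rw [smul_smul, inv_mul_cancel₀ hc, one_smul, abs_inv] at this
      rw [Real.norm_eq_abs]
      calc |c| * ‖μ‖ ≤ |c| * (|c|⁻¹ * ‖c • μ‖) := mul_le_mul_of_nonneg_left this (abs_nonneg c)
        _ = ‖c • μ‖ := by rw [← mul_assoc, mul_inv_cancel₀ (abs_ne_zero.2 hc), one_mul]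
  · refine csSup_le (variationSums_nonempty _) ?_
    rintro v ⟨P, hP, hd, rfl⟩
    calc ∑ E ∈ P, |(μ + ν) E| ≤ ∑ E ∈ P, (|μ E| + |ν E|) :=
          Finset.sum_le_sum fun E _ => abs_add_le _ _
      _ = ∑ E ∈ P, |μ E| + ∑ E ∈ P, |ν E| := Finset.sum_add_distrib
      _ ≤ ‖μ‖ + ‖ν‖ := add_le_add
          (le_csSup (variationSums_bddAbove μ) ⟨P, hP, hd, rfl⟩)
          (le_csSup (variationSums_bddAbove ν) ⟨P, hP, hd, rfl⟩)
  · refine Ba.ext fun E hE => ?_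
    have := μ.abs_apply_le_norm hE
    rw [h] at this
    exact abs_nonpos_iff.1 this
  · rintro rfl
    refine le_antisymm (csSup_le (variationSums_nonempty _) ?_) (h0 _)
    rintro v ⟨P, hP, hd, rfl⟩
    simp [Ba.zero_apply]

noncomputable instance : NormedAddCommGroup (Ba X) := NormedAddCommGroup.ofCore Ba.normedSpaceCore

noncomputable instance : NormedSpace ℝ (Ba X) := NormedSpace.ofCore Ba.normedSpaceCore

/-! ### Countably additive measures -/

/-- `ca(X, Σ)`: the subspace of countably additive measures in `ba(X, Σ)`, with the same norm. -/
def ca (X : Type*) [MeasurableSpace X] : Submodule ℝ (Ba X) where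
  carrier := {μ | ∀ E : ℕ → Set X, (∀ i, MeasurableSet (E i)) →
    (∀ i j, i ≠ j → Disjoint (E i) (E j)) → HasSum (fun i => μ (E i)) (μ (⋃ i, E i))}
  add_mem' := fun hμ hν E hE hd => (hμ E hE hd).add (hν E hE hd)
  zero_mem' := fun _ _ _ => hasSum_zero
  smul_mem' := fun c _ hμ E hE hd => (hμ E hE hd).mul_left c

/-! ### The integral of a bounded measurable function against a finitely additive measure -/

/-- The integral of a simple function. -/
noncomputable def simpleIntegral (μ : Ba X) (g : SimpleFunc X ℝ) : ℝ :=
  ∑ r ∈ g.range, r * μ (g ⁻¹' {r})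

/-- The filter of simple functions converging uniformly on `X` to `f`. -/
def uniformApprox (f : X → ℝ) : Filter (SimpleFunc X ℝ) :=
  ⨅ ε ∈ Set.Ioi (0 : ℝ), 𝓟 {g : SimpleFunc X ℝ | ∀ x, |g x - f x| ≤ ε}

/-- The integral of `f` against `μ`: the limit of the integrals of simple functions converging
uniformly to `f`. It is used only for bounded measurable `f`, where the limit exists by
`tendsto_integral`. -/
noncomputable def integral (μ : Ba X) (f : X → ℝ) : ℝ :=
  limUnder (uniformApprox f) (simpleIntegral μ)

theorem uniformApprox_hasBasis (f : X → ℝ) :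
    (uniformApprox f).HasBasis (fun ε : ℝ => 0 < ε)
      fun ε => {g : SimpleFunc X ℝ | ∀ x, |g x - f x| ≤ ε} := by
  refine hasBasis_biInf_principal ?_ ⟨1, Set.mem_Ioi.2 one_pos⟩
  intro a ha b hb
  exact ⟨min a b, Set.mem_Ioi.2 (lt_min ha hb), fun g hg x => (hg x).trans (min_le_left _ _),
    fun g hg x => (hg x).trans (min_le_right _ _)⟩

theorem exists_simple_approx {f : X → ℝ} (hf : Measurable f) {C : ℝ} (hC : ∀ x, |f x| ≤ C)
    {ε : ℝ} (hε : 0 < ε) : ∃ g : SimpleFunc X ℝ, ∀ x, |g x - f x| ≤ ε := by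
  have hm : Measurable fun x => (⌊f x / ε⌋ : ℤ) := (hf.div_const ε).floor
  let g : SimpleFunc X ℝ :=
    { toFun := fun x => (⌊f x / ε⌋ : ℝ) * ε
      measurableSet_fiber' := fun r =>
        (((measurable_from_top (f := fun n : ℤ => (n : ℝ))).comp hm).mul_const ε)
          (measurableSet_singleton r)
      finite_range' := by
        refine ((Set.finite_Icc ⌊-C / ε⌋ ⌊C / ε⌋).image fun n : ℤ => (n : ℝ) * ε).subset ?_
        rintro _ ⟨x, rfl⟩
        have h := abs_le.1 (hC x)
        refine ⟨⌊f x / ε⌋, ⟨Int.floor_le_floor ?_, Int.floor_le_floor ?_⟩, rfl⟩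
        · exact div_le_div_of_nonneg_right h.1 hε.le
        · exact div_le_div_of_nonneg_right h.2 hε.le }
  refine ⟨g, fun x => ?_⟩
  change |(⌊f x / ε⌋ : ℝ) * ε - f x| ≤ ε
  have h1 := Int.floor_le (f x / ε)
  have h2 := Int.lt_floor_add_one (f x / ε)
  rw [le_div_iff₀ hε] at h1
  rw [div_lt_iff₀ hε] at h2
  rw [abs_le]
  constructor <;> nlinarith

theorem uniformApprox_neBot {f : X → ℝ} (hf : Measurable f) {C : ℝ} (hC : ∀ x, |f x| ≤ C) :
    (uniformApprox f).NeBot :=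
  (uniformApprox_hasBasis f).neBot_iff.2 fun hε => exists_simple_approx hf hC hε

theorem simpleIntegral_eq (μ : Ba X) (g : SimpleFunc X ℝ) :
    simpleIntegral μ g =
      g.setToSimpleFunc (fun E => μ E • ContinuousLinearMap.id ℝ ℝ) := by
  simp [simpleIntegral, SimpleFunc.setToSimpleFunc, mul_comm]

theorem finMeasAdditive_id (μ : Ba X) :
    FinMeasAdditive (0 : Measure X) (fun E => μ E • ContinuousLinearMap.id ℝ ℝ) := by
  intro E F hE hF _ _ hd
  simp only [μ.union hE hF hd, add_smul]

theorem simpleIntegral_add (μ : Ba X) (g h : SimpleFunc X ℝ) :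
    simpleIntegral μ (g + h) = simpleIntegral μ g + simpleIntegral μ h := by
  simp only [simpleIntegral_eq]
  exact SimpleFunc.setToSimpleFunc_add _ (finMeasAdditive_id μ)
    (integrable_zero_measure) (integrable_zero_measure)

theorem simpleIntegral_sub (μ : Ba X) (g h : SimpleFunc X ℝ) :
    simpleIntegral μ (g - h) = simpleIntegral μ g - simpleIntegral μ h := by
  simp only [simpleIntegral_eq]
  exact SimpleFunc.setToSimpleFunc_sub _ (finMeasAdditive_id μ)
    (integrable_zero_measure) (integrable_zero_measure)

theorem abs_simpleIntegral_le (μ : Ba X) (g : SimpleFunc X ℝ) {C : ℝ} (hC : ∀ x, |g x| ≤ C) :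
    |simpleIntegral μ g| ≤ C * ‖μ‖ := by
  rcases isEmpty_or_nonempty X with hX | ⟨⟨x₀⟩⟩
  · have hμ : μ = 0 := Ba.ext fun E _ => by rw [Set.eq_empty_of_isEmpty E]; exact μ.empty
    simp [simpleIntegral, hμ, Ba.zero_apply]
  have hC0 : 0 ≤ C := (abs_nonneg _).trans (hC x₀)
  calc |simpleIntegral μ g| ≤ ∑ r ∈ g.range, |r * μ (g ⁻¹' {r})| := Finset.abs_sum_le_sum_abs _ _
    _ ≤ ∑ r ∈ g.range, C * |μ (g ⁻¹' {r})| := by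
        refine Finset.sum_le_sum fun r hr => ?_
        obtain ⟨x, rfl⟩ := SimpleFunc.mem_range.1 hr
        rw [abs_mul]
        exact mul_le_mul_of_nonneg_right (hC x) (abs_nonneg _)
    _ = C * ∑ r ∈ g.range, |μ (g ⁻¹' {r})| := by rw [Finset.mul_sum]
    _ ≤ C * ‖μ‖ := by
        refine mul_le_mul_of_nonneg_left ?_ hC0
        refine μ.sum_abs_le_norm g.range (fun r => g ⁻¹' {r})
          (fun r _ => g.measurableSet_fiber r) ?_
        intro r _ s _ hrs
        exact Disjoint.preimage _ (by simpa using hrs)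

/-- Existence of the integral of a bounded measurable function. -/
theorem tendsto_integral (μ : Ba X) {f : X → ℝ} (hf : Measurable f) {C : ℝ}
    (hC : ∀ x, |f x| ≤ C) :
    Tendsto (simpleIntegral μ) (uniformApprox f) (𝓝 (integral μ f)) := by
  have := uniformApprox_neBot hf hC
  have hcau : Cauchy (map (simpleIntegral μ) (uniformApprox f)) := by
    rw [Metric.cauchy_iff]
    refine ⟨inferInstance, fun ε hε => ?_⟩
    have hn : 0 < ‖μ‖ + 1 := by positivity
    set δ := ε / (4 * (‖μ‖ + 1)) with hδ
    have hδ0 : 0 < δ := by positivity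
    refine ⟨_, image_mem_map ((uniformApprox_hasBasis f).mem_of_mem hδ0), ?_⟩
    rintro _ ⟨g, hg, rfl⟩ _ ⟨h, hh, rfl⟩
    rw [Real.dist_eq, ← simpleIntegral_sub]
    have hb : ∀ x, |(g - h) x| ≤ 2 * δ := fun x => by
      have h1 := abs_le.1 (hg x)
      have h2 := abs_le.1 (hh x)
      rw [SimpleFunc.sub_apply, abs_le]
      constructor <;> linarith
    have h4 : 2 * δ * (‖μ‖ + 1) = ε / 2 := by rw [hδ]; field_simp; ring
    calc |simpleIntegral μ (g - h)| ≤ 2 * δ * ‖μ‖ := abs_simpleIntegral_le μ _ hb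
      _ < ε := by nlinarith
  exact le_nhds_lim (CompleteSpace.complete hcau)

theorem integral_eq_of_tendsto (μ : Ba X) {f : X → ℝ} (hf : Measurable f) {C : ℝ}
    (hC : ∀ x, |f x| ≤ C) {a : ℝ} (h : Tendsto (simpleIntegral μ) (uniformApprox f) (𝓝 a)) :
    integral μ f = a :=
  have := uniformApprox_neBot hf hC
  tendsto_nhds_unique (tendsto_integral μ hf hC) h

theorem integral_add_left (μ ν : Ba X) {f : X → ℝ} (hf : Measurable f) {C : ℝ}
    (hC : ∀ x, |f x| ≤ C) : integral (μ + ν) f = integral μ f + integral ν f := by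
  refine integral_eq_of_tendsto _ hf hC ?_
  refine ((tendsto_integral μ hf hC).add (tendsto_integral ν hf hC)).congr fun g => ?_
  simp [simpleIntegral, Ba.add_apply, mul_add, Finset.sum_add_distrib]

theorem integral_smul_left (c : ℝ) (μ : Ba X) {f : X → ℝ} (hf : Measurable f) {C : ℝ}
    (hC : ∀ x, |f x| ≤ C) : integral (c • μ) f = c * integral μ f := by
  refine integral_eq_of_tendsto _ hf hC ?_
  refine ((tendsto_integral μ hf hC).const_mul c).congr fun g => ?_
  simp only [simpleIntegral, Ba.smul_apply, Finset.mul_sum]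
  exact Finset.sum_congr rfl fun r _ => by ring

theorem integral_add_right (μ : Ba X) {f h : X → ℝ} (hf : Measurable f) {C : ℝ}
    (hC : ∀ x, |f x| ≤ C) (hh : Measurable h) {D : ℝ} (hD : ∀ x, |h x| ≤ D) :
    integral μ (fun x => f x + h x) = integral μ f + integral μ h := by
  have := uniformApprox_neBot hf hC
  have := uniformApprox_neBot hh hD
  have hCD : ∀ x, |f x + h x| ≤ C + D := fun x =>
    (abs_add_le _ _).trans (add_le_add (hC x) (hD x))
  have ht : Tendsto (fun q : SimpleFunc X ℝ × SimpleFunc X ℝ => q.1 + q.2)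
      (uniformApprox f ×ˢ uniformApprox h) (uniformApprox fun x => f x + h x) := by
    rw [(uniformApprox_hasBasis _).tendsto_right_iff]
    intro ε hε
    have h1 := (uniformApprox_hasBasis f).mem_of_mem (half_pos hε)
    have h2 := (uniformApprox_hasBasis h).mem_of_mem (half_pos hε)
    filter_upwards [prod_mem_prod h1 h2] with q hq x
    have a1 := abs_le.1 (hq.1 x)
    have a2 := abs_le.1 (hq.2 x)
    rw [SimpleFunc.add_apply, abs_le]
    constructor <;> linarith
  have l1 := (tendsto_integral μ (hf.add hh) hCD).comp ht
  have l2 := ((tendsto_integral μ hf hC).comp (tendsto_fst (g := uniformApprox h))).add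
    ((tendsto_integral μ hh hD).comp (tendsto_snd (f := uniformApprox f)))
  exact tendsto_nhds_unique l1 (l2.congr fun q => (simpleIntegral_add μ q.1 q.2).symm)

theorem abs_integral_le (μ : Ba X) {f : X → ℝ} (hf : Measurable f) {C : ℝ}
    (hC : ∀ x, |f x| ≤ C) : |integral μ f| ≤ C * ‖μ‖ := by
  have := uniformApprox_neBot hf hC
  refine le_of_forall_pos_le_add fun ε hε => ?_
  have hn : 0 < ‖μ‖ + 1 := by positivity
  have hδ0 : 0 < ε / (‖μ‖ + 1) := by positivity
  refine le_of_tendsto (tendsto_integral μ hf hC).abs ?_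
  filter_upwards [(uniformApprox_hasBasis f).mem_of_mem hδ0] with g hg
  have hb : ∀ x, |g x| ≤ C + ε / (‖μ‖ + 1) := fun x => by
    have h1 := abs_le.1 (hg x)
    have h2 := abs_le.1 (hC x)
    rw [abs_le]
    constructor <;> linarith
  refine (abs_simpleIntegral_le μ g hb).trans ?_
  have h5 : ε / (‖μ‖ + 1) * (‖μ‖ + 1) = ε := by field_simp
  nlinarith

/-! ### The Markov operator of a transition function -/

theorem abs_measureReal_le_one (p : Kernel X X) [IsMarkovKernel p] (E : Set X) (x : X) :
    |(p x).real E| ≤ 1 := by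
  rw [abs_of_nonneg measureReal_nonneg]
  exact measureReal_le_one

theorem measurable_measureReal (p : Kernel X X) {E : Set X} (hE : MeasurableSet E) :
    Measurable fun x => (p x).real E :=
  (p.measurable_coe hE).ennreal_toReal

open Classical in
/-- The measure `A μ`, with `(A μ)(E) = ∫ p(x, E) μ(dx)` for measurable `E`. -/
noncomputable def markovImage (p : Kernel X X) [IsMarkovKernel p] (μ : Ba X) : Ba X :=
  Ba.mk (fun E => if MeasurableSet E then integral μ (fun x => (p x).real E) else 0) (by
    refine ⟨fun E hE => if_neg hE, ?_, fun E F hE hF hd => ?_, ‖μ‖, fun E => ?_⟩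
    · simp only [if_pos MeasurableSet.empty]
      have := abs_integral_le μ (measurable_measureReal p MeasurableSet.empty) (C := 0)
        (by simp)
      rw [zero_mul] at this
      exact abs_nonpos_iff.1 this
    · simp only [if_pos (hE.union hF), if_pos hE, if_pos hF]
      rw [← integral_add_right μ (measurable_measureReal p hE) (abs_measureReal_le_one p E)
          (measurable_measureReal p hF) (abs_measureReal_le_one p F)]
      congr 1
      funext x
      exact measureReal_union hd hF
    · by_cases hE : MeasurableSet E
      · simp only [if_pos hE]
        simpa using abs_integral_le μ (measurable_measureReal p hE)
          (abs_measureReal_le_one p E)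
      · simp [if_neg hE])

theorem markovImage_apply (p : Kernel X X) [IsMarkovKernel p] (μ : Ba X) {E : Set X}
    (hE : MeasurableSet E) : markovImage p μ E = integral μ (fun x => (p x).real E) :=
  if_pos hE

/-- The Markov operator `A` on `ba(X, Σ)`: `(A μ)(E) = ∫ p(x, E) μ(dx)` for measurable `E`. -/
noncomputable def markovOp (p : Kernel X X) [IsMarkovKernel p] : Ba X →L[ℝ] Ba X :=
  LinearMap.mkContinuous
    { toFun := markovImage p
      map_add' := fun μ ν => Ba.ext fun E hE => by
        rw [Ba.add_apply, markovImage_apply p _ hE, markovImage_apply p _ hE,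
          markovImage_apply p _ hE]
        exact integral_add_left μ ν (measurable_measureReal p hE) (abs_measureReal_le_one p E)
      map_smul' := fun c μ => Ba.ext fun E hE => by
        rw [RingHom.id_apply, Ba.smul_apply, markovImage_apply p _ hE, markovImage_apply p _ hE]
        exact integral_smul_left c μ (measurable_measureReal p hE)
          (abs_measureReal_le_one p E) }
    2
    (fun μ => Ba.norm_le_two_mul (markovImage p μ) fun E hE => by
      rw [markovImage_apply p _ hE]
      simpa using abs_integral_le μ (measurable_measureReal p hE) (abs_measureReal_le_one p E))

theorem markovOp_apply (p : Kernel X X) [IsMarkovKernel p] (μ : Ba X) {E : Set X}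
    (hE : MeasurableSet E) : markovOp p μ E = integral μ (fun x => (p x).real E) :=
  markovImage_apply p μ hE

/-! ### The Markov operator preserves countable additivity -/

open Classical in
/-- A finite measure as an element of `ba(X, Σ)`. -/
noncomputable def ofMeasure (m : Measure X) [IsFiniteMeasure m] : Ba X :=
  Ba.mk (fun E => if MeasurableSet E then m.real E else 0) (by
    refine ⟨fun E hE => if_neg hE, by simp, fun E F hE hF hd => ?_, m.real Set.univ, fun E => ?_⟩
    · simp only [if_pos (hE.union hF), if_pos hE, if_pos hF]
      exact measureReal_union hd hF
    · by_cases hE : MeasurableSet E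
      · simp only [if_pos hE]
        rw [abs_of_nonneg measureReal_nonneg]
        exact measureReal_mono (Set.subset_univ E)
      · simp [if_neg hE])

theorem ofMeasure_apply (m : Measure X) [IsFiniteMeasure m] {E : Set X} (hE : MeasurableSet E) :
    ofMeasure m E = m.real E := if_pos hE

theorem ofMeasure_mem_ca (m : Measure X) [IsFiniteMeasure m] : ofMeasure m ∈ ca X := by
  intro E hE hd
  rw [ofMeasure_apply m (MeasurableSet.iUnion hE)]
  simp only [ofMeasure_apply m (hE _)]
  have h := (m.toSignedMeasure).m_iUnion hE fun i j hij => hd i j hij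
  simpa only [Measure.toSignedMeasure_apply_measurable (hE _),
    Measure.toSignedMeasure_apply_measurable (MeasurableSet.iUnion hE)] using h

/-- For a finite measure the integral is the Lebesgue integral. -/
theorem integral_ofMeasure (m : Measure X) [IsFiniteMeasure m] {f : X → ℝ} (hf : Measurable f)
    {C : ℝ} (hC : ∀ x, |f x| ≤ C) : integral (ofMeasure m) f = ∫ x, f x ∂m := by
  refine integral_eq_of_tendsto _ hf hC ?_
  have hfi : Integrable f m :=
    Integrable.of_bound hf.aestronglyMeasurable C (Eventually.of_forall hC)
  rw [Metric.tendsto_nhds]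
  intro ε hε
  have hn : 0 < m.real Set.univ + 1 := by positivity
  have hδ0 : 0 < ε / (m.real Set.univ + 1) := by positivity
  filter_upwards [(uniformApprox_hasBasis f).mem_of_mem hδ0] with g hg
  have hgi : Integrable g m := SimpleFunc.integrable_of_isFiniteMeasure g
  have hs : simpleIntegral (ofMeasure m) g = ∫ x, g x ∂m := by
    rw [SimpleFunc.integral_eq_sum _ hgi]
    refine Finset.sum_congr rfl fun r _ => ?_
    rw [ofMeasure_apply m (g.measurableSet_fiber r), smul_eq_mul, mul_comm]
  rw [hs, Real.dist_eq, ← integral_sub hgi hfi]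
  have := norm_integral_le_of_norm_le_const (μ := m) (f := fun x => g x - f x)
    (Eventually.of_forall hg)
  rw [Real.norm_eq_abs] at this
  refine this.trans_lt ?_
  have h5 : ε / (m.real Set.univ + 1) * (m.real Set.univ + 1) = ε := by field_simp
  nlinarith

theorem markovOp_ofMeasure (p : Kernel X X) [IsMarkovKernel p] (m : Measure X)
    [IsFiniteMeasure m] : markovOp p (ofMeasure m) = ofMeasure (m.bind p) := by
  refine Ba.ext fun E hE => ?_
  rw [markovOp_apply p _ hE, ofMeasure_apply _ hE,
    integral_ofMeasure m (measurable_measureReal p hE) (abs_measureReal_le_one p E)]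
  simp only [Measure.real]
  rw [Measure.bind_apply hE p.aemeasurable, integral_toReal (p.measurable_coe hE).aemeasurable
    (Eventually.of_forall fun x => measure_lt_top _ _)]

theorem exists_eq_sub_ofMeasure {μ : Ba X} (hμ : μ ∈ ca X) :
    ∃ (m n : Measure X) (_ : IsFiniteMeasure m) (_ : IsFiniteMeasure n),
      μ = ofMeasure m - ofMeasure n := by
  let s : SignedMeasure X :=
    { measureOf' := μ
      empty' := μ.empty
      not_measurable' := fun E hE => μ.not_measurable hE
      m_iUnion' := fun E hE hd => hμ E hE fun i j hij => hd hij }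
  refine ⟨s.toJordanDecomposition.posPart, s.toJordanDecomposition.negPart,
    inferInstance, inferInstance, Ba.ext fun E hE => ?_⟩
  rw [Ba.sub_apply, ofMeasure_apply _ hE, ofMeasure_apply _ hE]
  exact s.apply_eq_posPart_real_sub_negPart_real hE

theorem markovOp_mem_ca (p : Kernel X X) [IsMarkovKernel p] {μ : Ba X} (hμ : μ ∈ ca X) :
    markovOp p μ ∈ ca X := by
  obtain ⟨m, n, _, _, rfl⟩ := exists_eq_sub_ofMeasure hμ
  rw [map_sub, markovOp_ofMeasure, markovOp_ofMeasure]
  exact (ca X).sub_mem (ofMeasure_mem_ca _) (ofMeasure_mem_ca _)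

/-- The Markov operator `A` on `ca(X, Σ)`. -/
noncomputable def markovOpCa (p : Kernel X X) [IsMarkovKernel p] : ca X →L[ℝ] ca X :=
  ((markovOp p).comp (ca X).subtypeL).codRestrict (ca X) fun μ => markovOp_mem_ca p μ.2

/-! ### Invariant probability measures and the conditions on the chain -/

/-- `Δ_ba`: the invariant finitely additive probability measures. -/
def invBa (p : Kernel X X) [IsMarkovKernel p] : Set (Ba X) :=
  {μ | (∀ E, 0 ≤ μ E) ∧ ‖μ‖ = 1 ∧ markovOp p μ = μ}

/-- `Δ_ca`: the invariant countably additive probability measures. -/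
def invCa (p : Kernel X X) [IsMarkovKernel p] : Set (Ba X) :=
  {μ | μ ∈ ca X ∧ (∀ E, 0 ≤ μ E) ∧ ‖μ‖ = 1 ∧ markovOp p μ = μ}

/-- The algebraic dimension of a set of measures: the dimension of its linear span. -/
noncomputable def linDim (S : Set (Ba X)) : Cardinal :=
  Module.rank ℝ (Submodule.span ℝ S)

/-- The Doeblin condition (D). Here `p ^ k` is the `k`-step transition function. -/
def DoeblinCondition (p : Kernel X X) : Prop :=
  ∃ φ ∈ ca X, (∀ E, 0 ≤ φ E) ∧ ∃ ε : ℝ, 0 < ε ∧ ∃ k : ℕ, 1 ≤ k ∧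
    ∀ E, MeasurableSet E → φ E ≤ ε → ∀ x, ((p ^ k) x).real E ≤ 1 - ε

/-- The Cesàro averaged transition function `q_m(x, E) = (1/m) ∑_{k=1}^m p^k(x, E)`. -/
noncomputable def cesaroTransition (p : Kernel X X) (m : ℕ) (x : X) (E : Set X) : ℝ :=
  (1 / (m : ℝ)) * ∑ k ∈ Finset.Icc 1 m, ((p ^ k) x).real E

/-- The averaged Doeblin condition (D̃). -/
def AveragedDoeblinCondition (p : Kernel X X) : Prop :=
  ∃ φ ∈ ca X, (∀ E, 0 ≤ φ E) ∧ ∃ ε : ℝ, 0 < ε ∧ ∃ m : ℕ, 1 ≤ m ∧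
    ∀ E, MeasurableSet E → φ E < ε → ∀ x, cesaroTransition p m x E ≤ 1 - ε

/-- Quasicompactness (K): some power of `A` on `ca(X, Σ)` is at distance less than `1`, in
operator norm, from a compact operator. -/
def QuasicompactCondition (p : Kernel X X) [IsMarkovKernel p] : Prop :=
  ∃ (B : ca X →L[ℝ] ca X) (k : ℕ), IsCompactOperator B ∧ 1 ≤ k ∧ ‖markovOpCa p ^ k - B‖ < 1

end

end MarkovCharge

namespace MarkovCharge

/-! ### Finitely additive measures: norms, integrals and setwise limits -/

section FinitelyAdditive

variable {X : Type*} [MeasurableSpace X]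

/-! Elements of `invBa p` have total mass 1, so dimension one means that there is exactly one, μ.
The averages q_n(x, ·) satisfy ‖A q_n − q_n‖ ≤ 2/n, so every setwise limit of them along an
ultrafilter with n → ∞ is invariant and hence equals μ, even when x varies with n. Thus q_n(x, E) →
μ(E) uniformly in x for each E (`cesaroTransition_tendsto_uniform`). For a fixed x this exhibits μ
as a setwise limit of measures, and Nikodym's theorem (`tendsto_zero_of_setwise_limit`) makes it a
measure m.

A union of badly behaved sets with summable m-measures would contradict this uniform convergence.
So, for each η > 0, there is an n for which q_n(x, E) ≤ η for all x as soon as m(E) is small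
(`exists_cesaroTransition_le`); invariance of m and Markov's inequality transfer this to a single
power p^n (`exists_pow_le`). With η = 1/2 these are the two Doeblin conditions, with φ = m.

For quasicompactness, the joint law m ⊗ p^l is, up to small mass, absolutely continuous with respect
to m × m. Approximating its density in L¹ by a function that is constant in the first variable on
the cells of a finite partition makes all functions p^l(·, E) close in L¹(m) to functions constant
on these cells (`exists_partition_integral_le`). Running p^n first turns L¹(m)-closeness into
uniform closeness, so A^(n+l) is within 1/8 of an operator of finite rank
(`quasicompactCondition_of_partition`). -/

theorem Ba.sum_apply {ι : Type*} (s : Finset ι) (μ : ι → Ba X) (E : Set X) :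
    (∑ i ∈ s, μ i) E = ∑ i ∈ s, μ i E := by
  classical
  induction s using Finset.induction_on with
  | empty => simp [Ba.zero_apply]
  | insert a s ha ih => rw [Finset.sum_insert ha, Finset.sum_insert ha, Ba.add_apply, ih]

theorem Ba.diff (μ : Ba X) {E F : Set X} (hE : MeasurableSet E) (hF : MeasurableSet F)
    (h : F ⊆ E) : μ (E \ F) = μ E - μ F := by
  have := μ.union hF (hE.diff hF) Set.disjoint_sdiff_right
  rw [Set.union_sdiff_cancel h] at this
  linarith

theorem Ba.mono {μ : Ba X} (hμ : ∀ E, 0 ≤ μ E) {E F : Set X} (hE : MeasurableSet E)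
    (hF : MeasurableSet F) (h : E ⊆ F) : μ E ≤ μ F := by
  have := μ.diff hF hE h
  linarith [hμ (F \ E)]

theorem Ba.norm_of_nonneg {μ : Ba X} (hμ : ∀ E, 0 ≤ μ E) : ‖μ‖ = μ Set.univ := by
  refine le_antisymm (csSup_le (variationSums_nonempty μ) ?_)
    ((le_abs_self _).trans (μ.abs_apply_le_norm MeasurableSet.univ))
  rintro v ⟨P, hP, hd, rfl⟩
  have h1 := μ.biUnion P id (fun i hi => hP i hi) hd
  simp only [id] at h1
  calc ∑ E ∈ P, |μ E| = ∑ E ∈ P, μ E := Finset.sum_congr rfl fun E _ => abs_of_nonneg (hμ E)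
    _ ≤ μ Set.univ := by
      rw [← h1]
      exact Ba.mono hμ (Finset.measurableSet_biUnion _ hP) MeasurableSet.univ (Set.subset_univ _)

theorem Ba.continuous_eval (E : Set X) : Continuous fun μ : Ba X => μ E := by
  by_cases hE : MeasurableSet E
  · refine (LipschitzWith.of_dist_le_mul (K := 1) fun μ ν => ?_).continuous
    rw [Real.dist_eq, dist_eq_norm, NNReal.coe_one, one_mul, ← Ba.sub_apply]
    exact (μ - ν).abs_apply_le_norm hE
  · simp only [fun μ : Ba X => μ.not_measurable hE]
    exact continuous_const

theorem ofMeasure_nonneg (m : Measure X) [IsFiniteMeasure m] (E : Set X) :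
    0 ≤ ofMeasure m E := by
  by_cases hE : MeasurableSet E
  · rw [ofMeasure_apply m hE]
    exact measureReal_nonneg
  · rw [(ofMeasure m).not_measurable hE]

theorem norm_ofMeasure (m : Measure X) [IsFiniteMeasure m] :
    ‖ofMeasure m‖ = m.real Set.univ := by
  rw [Ba.norm_of_nonneg (ofMeasure_nonneg m), ofMeasure_apply m MeasurableSet.univ]

theorem integral_sub_left (μ ν : Ba X) {f : X → ℝ} (hf : Measurable f) {C : ℝ}
    (hC : ∀ x, |f x| ≤ C) : integral (μ - ν) f = integral μ f - integral ν f := by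
  have h1 := integral_add_left (μ - ν) ν hf hC
  rw [sub_add_cancel] at h1
  linarith

theorem abs_integral_sub_simpleIntegral_le (μ : Ba X) {f : X → ℝ} (hf : Measurable f) {C : ℝ}
    (hC : ∀ x, |f x| ≤ C) (g : SimpleFunc X ℝ) {ε : ℝ} (hg : ∀ x, |g x - f x| ≤ ε) :
    |integral μ f - simpleIntegral μ g| ≤ ε * ‖μ‖ := by
  have := uniformApprox_neBot hf hC
  refine le_of_forall_pos_le_add fun η hη => ?_
  have hn : 0 < ‖μ‖ + 1 := by positivity
  have hδ0 : 0 < η / (‖μ‖ + 1) := by positivity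
  refine le_of_tendsto ((tendsto_integral μ hf hC).sub_const (simpleIntegral μ g)).abs ?_
  filter_upwards [(uniformApprox_hasBasis f).mem_of_mem hδ0] with g' hg'
  rw [← simpleIntegral_sub]
  have hb : ∀ x, |(g' - g) x| ≤ ε + η / (‖μ‖ + 1) := fun x => by
    have h1 := abs_le.1 (hg' x)
    have h2 := abs_le.1 (hg x)
    rw [SimpleFunc.sub_apply, abs_le]
    constructor <;> linarith
  refine (abs_simpleIntegral_le μ _ hb).trans ?_
  have h5 : η / (‖μ‖ + 1) * (‖μ‖ + 1) = η := by field_simp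
  nlinarith [norm_nonneg μ]

/-- Bounded sequences of finitely additive measures converge setwise along ultrafilters. -/
theorem exists_tendsto_ultrafilter {ι : Type*} (U : Ultrafilter ι) (ν : ι → Ba X)
    (hν : ∀ j, ‖ν j‖ ≤ 1) : ∃ μ : Ba X, ∀ E, Tendsto (fun j => ν j E) U (𝓝 (μ E)) := by
  have hb : ∀ j E, |ν j E| ≤ 1 := fun j E => by
    by_cases hE : MeasurableSet E
    · exact ((ν j).abs_apply_le_norm hE).trans (hν j)
    · simp [(ν j).not_measurable hE]
  -- The values on each E lie in the compact interval [-1, 1], and an ultrafilter converges for all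
  -- E simultaneously; a subsequence would have to depend on E.
  have hlim : ∀ E, ∃ a : ℝ, Tendsto (fun j => ν j E) U (𝓝 a) ∧ |a| ≤ 1 := fun E => by
    obtain ⟨a, ha, h⟩ := (isCompact_Icc (a := (-1 : ℝ)) (b := 1)).ultrafilter_le_nhds
      (U.map fun j => ν j E) (by
        simp only [Ultrafilter.coe_map, le_principal_iff, mem_map]
        exact Filter.univ_mem' fun j => abs_le.1 (hb j E))
    exact ⟨a, h, abs_le.2 ha⟩
  choose a ha ha1 using hlim
  refine ⟨Ba.mk a ⟨fun E hE => ?_, ?_, fun E F hE hF hd => ?_, 1, ha1⟩, ha⟩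
  · refine tendsto_nhds_unique (ha E) ?_
    simp only [fun j => (ν j).not_measurable hE]
    exact tendsto_const_nhds
  · refine tendsto_nhds_unique (ha ∅) ?_
    simp only [fun j => (ν j).empty]
    exact tendsto_const_nhds
  · refine tendsto_nhds_unique (ha (E ∪ F)) ?_
    simp only [fun j => (ν j).union hE hF hd]
    exact (ha E).add (ha F)

/-- The uniform norm bound lets one simple function approximate the integral for all `ν j` at once.
This is what carries invariance to setwise limits, since `markovOp p μ E` is such an integral. -/
theorem tendsto_integral_of_tendsto_apply {ι : Type*} {l : Filter ι} {ν : ι → Ba X} {μ : Ba X}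
    (hν : ∀ j, ‖ν j‖ ≤ 1) (h : ∀ E, Tendsto (fun j => ν j E) l (𝓝 (μ E)))
    {f : X → ℝ} (hf : Measurable f) {C : ℝ} (hC : ∀ x, |f x| ≤ C) :
    Tendsto (fun j => integral (ν j) f) l (𝓝 (integral μ f)) := by
  rw [Metric.tendsto_nhds]
  intro ε hε
  have hn : 0 < ‖μ‖ + 1 := by positivity
  -- The first term of the minimum serves `ν j`, of norm at most 1; the second serves `μ`, whose
  -- norm is not bounded by hypothesis.
  obtain ⟨g, hg⟩ := exists_simple_approx hf hC
    (show 0 < min (ε / 3) (ε / (3 * (‖μ‖ + 1))) by positivity)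
  have h1 : Tendsto (fun j => simpleIntegral (ν j) g) l (𝓝 (simpleIntegral μ g)) :=
    tendsto_finsetSum _ fun r _ => (h _).const_mul r
  filter_upwards [Metric.tendsto_nhds.1 h1 (ε / 3) (by positivity)] with j hj
  have h2 := abs_integral_sub_simpleIntegral_le (ν j) hf hC g
    (fun x => (hg x).trans (min_le_left _ _))
  have h3 := abs_integral_sub_simpleIntegral_le μ hf hC g
    (fun x => (hg x).trans (min_le_right _ _))
  have h4 : ε / 3 * ‖ν j‖ ≤ ε / 3 := mul_le_of_le_one_right (by positivity) (hν j)
  have h5 : ε / (3 * (‖μ‖ + 1)) * ‖μ‖ ≤ ε / 3 := by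
    rw [div_mul_eq_mul_div, div_le_div_iff₀ (by positivity) (by positivity)]
    nlinarith
  rw [Real.dist_eq] at hj ⊢
  have h6 := abs_le.1 (h2.trans h4)
  have h7 := abs_le.1 (h3.trans h5)
  have h8 := abs_lt.1 hj
  rw [abs_lt]
  constructor <;> linarith

end FinitelyAdditive

/-! ### Cesàro averages of the transition function and their setwise limits -/

section Kernel

theorem bind_pow_succ {X : Type*} [MeasurableSpace X] (p : Kernel X X) (x : X) (n : ℕ) :
    ((p ^ n) x).bind p = (p ^ (n + 1)) x := by
  ext E hE
  rw [Kernel.pow_succ_apply_eq_lintegral p n x hE, Measure.bind_apply hE p.aemeasurable]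

variable {X : Type*} [MeasurableSpace X] (p : Kernel X X) [IsMarkovKernel p]

instance isMarkovKernel_pow (n : ℕ) : IsMarkovKernel (p ^ n) := by
  induction n with
  | zero => exact inferInstanceAs (IsMarkovKernel (Kernel.id : Kernel X X))
  | succ n ih =>
    rw [pow_succ]
    exact inferInstanceAs (IsMarkovKernel ((p ^ n) ∘ₖ p))

theorem real_bind_eq_integral (m : Measure X) [IsFiniteMeasure m] (κ : Kernel X X)
    [IsMarkovKernel κ] {E : Set X} (hE : MeasurableSet E) :
    (m.bind κ).real E = ∫ x, (κ x).real E ∂m := by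
  simp only [Measure.real]
  rw [Measure.bind_apply hE κ.aemeasurable, integral_toReal (κ.measurable_coe hE).aemeasurable
    (Eventually.of_forall fun x => measure_lt_top _ _)]

theorem real_pow_add_eq_integral (j k : ℕ) (x : X) {E : Set X} (hE : MeasurableSet E) :
    ((p ^ (j + k)) x).real E = ∫ y, ((p ^ k) y).real E ∂((p ^ j) x) := by
  rw [← real_bind_eq_integral _ _ hE]
  simp only [Measure.real]
  rw [Kernel.pow_add_apply_eq_lintegral p j k x hE,
    Measure.bind_apply hE (p ^ k).aemeasurable]

/-- The averaged transition probability `q_n(x, ·)` as an element of `ba(X, Σ)`. -/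
noncomputable def cesaroBa (n : ℕ) (x : X) : Ba X :=
  (1 / (n : ℝ)) • ∑ k ∈ Finset.Icc 1 n, ofMeasure ((p ^ k) x)

theorem cesaroBa_apply (n : ℕ) (x : X) {E : Set X} (hE : MeasurableSet E) :
    cesaroBa p n x E = cesaroTransition p n x E := by
  rw [cesaroBa, cesaroTransition, Ba.smul_apply, Ba.sum_apply]
  simp only [ofMeasure_apply _ hE]

theorem cesaroBa_nonneg (n : ℕ) (x : X) (E : Set X) : 0 ≤ cesaroBa p n x E := by
  rw [cesaroBa, Ba.smul_apply, Ba.sum_apply]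
  exact mul_nonneg (by positivity) (Finset.sum_nonneg fun k _ => ofMeasure_nonneg _ E)

theorem cesaroTransition_univ {n : ℕ} (hn : 1 ≤ n) (x : X) :
    cesaroTransition p n x Set.univ = 1 := by
  have : (n : ℝ) ≠ 0 := by positivity
  simp [cesaroTransition, this]

theorem norm_cesaroBa {n : ℕ} (hn : 1 ≤ n) (x : X) : ‖cesaroBa p n x‖ = 1 := by
  rw [Ba.norm_of_nonneg (cesaroBa_nonneg p n x), cesaroBa_apply p n x MeasurableSet.univ,
    cesaroTransition_univ p hn]

theorem markovOp_cesaroBa_sub (n : ℕ) (x : X) :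
    markovOp p (cesaroBa p n x) - cesaroBa p n x =
      (1 / (n : ℝ)) • (ofMeasure ((p ^ (n + 1)) x) - ofMeasure ((p ^ 1) x)) := by
  have h : ∀ n : ℕ, ∑ k ∈ Finset.Icc 1 n, ofMeasure ((p ^ (k + 1)) x) -
      ∑ k ∈ Finset.Icc 1 n, ofMeasure ((p ^ k) x) =
      ofMeasure ((p ^ (n + 1)) x) - ofMeasure ((p ^ 1) x) := by
    intro n
    induction n with
    | zero => simp
    | succ n ih =>
      rw [Finset.sum_Icc_succ_top (by omega), Finset.sum_Icc_succ_top (by omega),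
        add_sub_add_comm, ih]
      abel
  rw [cesaroBa, map_smul, map_sum, ← smul_sub, ← h]
  simp only [markovOp_ofMeasure, bind_pow_succ]

theorem norm_markovOp_cesaroBa_sub_le (n : ℕ) (x : X) :
    ‖markovOp p (cesaroBa p n x) - cesaroBa p n x‖ ≤ 2 / n := by
  rw [markovOp_cesaroBa_sub, norm_smul, Real.norm_of_nonneg (by positivity)]
  have h := norm_sub_le (ofMeasure ((p ^ (n + 1)) x)) (ofMeasure ((p ^ 1) x))
  rw [norm_ofMeasure, norm_ofMeasure, probReal_univ, probReal_univ] at h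
  calc 1 / (n : ℝ) * _ ≤ 1 / n * (1 + 1) := mul_le_mul_of_nonneg_left h (by positivity)
    _ = 2 / n := by ring

/-- Setwise limits of averaged transition probabilities are invariant. -/
theorem exists_mem_invBa_tendsto (U : Ultrafilter ℕ) {n : ℕ → ℕ} (hn1 : ∀ j, 1 ≤ n j)
    (hn : Tendsto n U atTop) (x : ℕ → X) :
    ∃ μ ∈ invBa p, ∀ E, Tendsto (fun j => cesaroBa p (n j) (x j) E) U (𝓝 (μ E)) := by
  have hnorm : ∀ j, ‖cesaroBa p (n j) (x j)‖ ≤ 1 := fun j => (norm_cesaroBa p (hn1 j) _).le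
  obtain ⟨μ, hμ⟩ := exists_tendsto_ultrafilter U (fun j => cesaroBa p (n j) (x j)) hnorm
  have h0 : ∀ E, 0 ≤ μ E := fun E =>
    ge_of_tendsto (hμ E) (Eventually.of_forall fun j => cesaroBa_nonneg p _ _ E)
  refine ⟨μ, ⟨h0, ?_, Ba.ext fun E hE => ?_⟩, hμ⟩
  · rw [Ba.norm_of_nonneg h0]
    refine tendsto_nhds_unique (hμ Set.univ) ?_
    simp only [cesaroBa_apply p _ _ MeasurableSet.univ, cesaroTransition_univ p (hn1 _)]
    exact tendsto_const_nhds
  · have h1 := tendsto_integral_of_tendsto_apply hnorm hμ (measurable_measureReal p hE)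
      (abs_measureReal_le_one p E)
    simp only [← markovOp_apply p _ hE] at h1
    have h2 : Tendsto (fun j => markovOp p (cesaroBa p (n j) (x j)) E -
        cesaroBa p (n j) (x j) E) U (𝓝 0) := by
      refine squeeze_zero_norm (fun j => ?_)
        ((tendsto_const_div_atTop_nhds_zero_nat 2).comp hn)
      rw [← Ba.sub_apply]
      exact (Ba.abs_apply_le_norm _ hE).trans (norm_markovOp_cesaroBa_sub_le p _ _)
    have h3 := h1.sub (hμ E)
    linarith [tendsto_nhds_unique h2 h3]

/-- In a one-dimensional span two invariant probabilities are proportional, and total mass 1 fixes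
the factor. The empty set is excluded because its span has rank 0. -/
theorem invBa_eq_singleton (h : linDim (invBa p) = 1) : ∃ μ, invBa p = {μ} := by
  have hne : (invBa p).Nonempty := by
    rw [Set.nonempty_iff_ne_empty]
    intro h0
    rw [linDim, h0, Submodule.span_empty, rank_bot] at h
    exact zero_ne_one h
  obtain ⟨μ, hμ⟩ := hne
  refine ⟨μ, Set.eq_singleton_iff_unique_mem.2 ⟨hμ, fun ν hν => ?_⟩⟩
  let v : Submodule.span ℝ (invBa p) := ⟨μ, Submodule.subset_span hμ⟩
  let w : Submodule.span ℝ (invBa p) := ⟨ν, Submodule.subset_span hν⟩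
  have hv : v ≠ 0 := by
    intro hv
    have : μ = 0 := congrArg Subtype.val hv
    have h1 := hμ.2.1
    rw [this, norm_zero] at h1
    exact zero_ne_one h1
  have hfin : Module.finrank ℝ (Submodule.span ℝ (invBa p)) = 1 := by
    rw [Module.finrank]
    rw [linDim] at h
    rw [h, Cardinal.one_toNat]
  obtain ⟨c, hc⟩ := (finrank_eq_one_iff_of_nonzero' v hv).1 hfin w
  have hc' : c • μ = ν := congrArg Subtype.val hc
  have e1 : μ Set.univ = 1 := by rw [← Ba.norm_of_nonneg hμ.1]; exact hμ.2.1
  have e2 : ν Set.univ = 1 := by rw [← Ba.norm_of_nonneg hν.1]; exact hν.2.1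
  rw [← hc', Ba.smul_apply, e1, mul_one] at e2
  rw [← hc', e2, one_smul]

/-- If the invariant finitely additive probability is unique, the averages `q_n(x, E)` converge
to it uniformly in `x`. -/
theorem cesaroTransition_tendsto_uniform {μ : Ba X} (h : invBa p = {μ}) {E : Set X}
    (hE : MeasurableSet E) {ε : ℝ} (hε : 0 < ε) :
    ∃ N, ∀ n ≥ N, ∀ x, |cesaroTransition p n x E - μ E| < ε := by
  by_contra! hcon
  -- The bad points `x` vary with the index; uniformity in `x` comes from allowing this in
  -- `exists_mem_invBa_tendsto`. The shift to `N + 1` keeps `n` positive.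
  choose n hn x hx using fun N => hcon (N + 1)
  have hU : ((hyperfilter ℕ : Ultrafilter ℕ) : Filter ℕ) ≤ atTop := by
    rw [← Nat.cofinite_eq_atTop]
    exact hyperfilter_le_cofinite
  obtain ⟨ν, hν, hlim⟩ := exists_mem_invBa_tendsto p (hyperfilter ℕ) (n := n)
    (fun j => le_trans (by omega) (hn j))
    ((tendsto_atTop_mono (fun j => (Nat.le_succ j).trans (hn j)) tendsto_id).mono_left hU) x
  rw [h, Set.mem_singleton_iff] at hν
  subst hν
  have h1 := ((hlim E).sub_const (ν E)).abs
  rw [sub_self, abs_zero] at h1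
  simp only [cesaroBa_apply p _ _ hE] at h1
  exact hε.not_ge (ge_of_tendsto h1 (Eventually.of_forall hx))

end Kernel

/-! ### Countable additivity of setwise limits -/

section Nikodym

variable {X : Type*} [MeasurableSpace X]

/-- Nikodym's convergence theorem for nonnegative measures: a setwise limit of countably additive
measures is continuous at the empty set. -/
theorem tendsto_zero_of_setwise_limit {m : ℕ → Measure X} [∀ n, IsFiniteMeasure (m n)]
    {μ : Ba X} (hμ : ∀ E, 0 ≤ μ E)
    (hlim : ∀ E, MeasurableSet E → Tendsto (fun n => (m n).real E) atTop (𝓝 (μ E)))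
    {E : ℕ → Set X} (hE : ∀ j, MeasurableSet (E j)) (hanti : Antitone E)
    (hempty : ⋂ j, E j = ∅) : Tendsto (fun j => μ (E j)) atTop (𝓝 0) := by
  have hmono : Antitone fun j => μ (E j) := fun i j hij => Ba.mono hμ (hE j) (hE i) (hanti hij)
  have hbdd : BddBelow (Set.range fun j => μ (E j)) := ⟨0, by rintro _ ⟨j, rfl⟩; exact hμ _⟩
  have htend := tendsto_atTop_ciInf hmono hbdd
  set δ := ⨅ j, μ (E j) with hδ
  have hδle : ∀ j, δ ≤ μ (E j) := fun j => ciInf_le hbdd j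
  have hδ0 : 0 ≤ δ := le_ciInf fun j => hμ _
  rcases hδ0.eq_or_lt with h0 | hpos
  · rwa [← h0] at htend
  exfalso
  -- Since `μ (E j) ≥ δ` for all `j`, the difference `E j₀ \ E j` has `μ`-mass below `δ / 10` for
  -- every `j ≥ j₀`.
  obtain ⟨j₀, hj₀⟩ := ((tendsto_order.1 htend).2 (δ + δ / 10) (by linarith)).exists
  have hm0 : ∀ n, Tendsto (fun j => (m n).real (E j)) atTop (𝓝 0) := fun n => by
    have h := tendsto_measure_iInter_atTop (μ := m n) (fun j => (hE j).nullMeasurableSet) hanti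
      ⟨0, measure_ne_top _ _⟩
    rw [hempty, measure_empty] at h
    exact (ENNReal.tendsto_toReal ENNReal.zero_ne_top).comp h
  -- Gliding hump: `m n` imitates `μ` on `E j`, while its own continuity at the empty set forces
  -- most of that mass into `E j \ E j'`. The guard `j₀ ≤ j` keeps the statement true for all `j`,
  -- so that `choose` gives total functions.
  have hstep : ∀ j N : ℕ, ∃ n j', N < n ∧ j < j' ∧
      (j₀ ≤ j → (m n).real (E j₀ \ E j) ≤ δ / 5) ∧
      9 / 10 * δ ≤ (m n).real (E j) ∧ (m n).real (E j') ≤ δ / 10 := by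
    intro j N
    have e1 := (tendsto_order.1 (hlim _ (hE j))).1 (9 / 10 * δ) (by linarith [hδle j])
    have e2 : ∀ᶠ n in atTop, j₀ ≤ j → (m n).real (E j₀ \ E j) ≤ δ / 5 := by
      by_cases hj : j₀ ≤ j
      · have hd : μ (E j₀ \ E j) < δ / 5 := by
          rw [μ.diff (hE _) (hE _) (hanti hj)]
          linarith [hδle j]
        filter_upwards [(tendsto_order.1 (hlim _ ((hE j₀).diff (hE j)))).2 _ hd] with n hn _
        exact hn.le
      · exact Eventually.of_forall fun n h => absurd h hj
    obtain ⟨n, ⟨hn1, hn2⟩, hn3⟩ := ((e1.and e2).and (eventually_gt_atTop N)).exists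
    obtain ⟨j', hj1, hj2⟩ := (((tendsto_order.1 (hm0 n)).2 (δ / 10) (by linarith)).and
      (eventually_gt_atTop j)).exists
    exact ⟨n, j', hn3, hj2, hn2, hn1.le, hj1.le⟩
  choose nf jf hnf hjf hA hB hC using hstep
  let s : ℕ → ℕ × ℕ := fun k => Nat.rec (0, j₀) (fun _ q => (nf q.2 q.1, jf q.2 q.1)) k
  have hs : ∀ k, s (k + 1) = (nf (s k).2 (s k).1, jf (s k).2 (s k).1) := fun k => rfl
  have hJ : StrictMono fun k => (s k).2 := strictMono_nat_of_lt_succ fun k => by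
    rw [hs]; exact hjf _ _
  have hN : StrictMono fun k => (s k).1 := strictMono_nat_of_lt_succ fun k => by
    rw [hs]; exact hnf _ _
  have hjge : ∀ k, j₀ ≤ (s k).2 := fun k => hJ.monotone (Nat.zero_le k)
  have hA' : ∀ k, (m (s (k + 1)).1).real (E j₀ \ E (s k).2) ≤ δ / 5 := fun k => by
    rw [hs]; exact hA _ _ (hjge k)
  have hB' : ∀ k, 9 / 10 * δ ≤ (m (s (k + 1)).1).real (E (s k).2) := fun k => by
    rw [hs]; exact hB _ _
  have hC' : ∀ k, (m (s (k + 1)).1).real (E (s (k + 1)).2) ≤ δ / 10 := fun k => by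
    rw [hs]; exact hC _ _
  -- Only every second hump is kept. Measures of odd index have their hump inside `D` and give it at
  -- least `4 / 5 * δ`; those of positive even index have it outside and give at most `3 / 10 * δ`.
  -- Hence the masses of `D` cannot converge.
  let D : Set X := ⋃ i, E (s (2 * i)).2 \ E (s (2 * i + 1)).2
  have hD : MeasurableSet D := MeasurableSet.iUnion fun i => (hE _).diff (hE _)
  have heven : ∀ i, 4 / 5 * δ ≤ (m (s (2 * i + 1)).1).real D := fun i => by
    have h1 : E (s (2 * i)).2 \ E (s (2 * i + 1)).2 ⊆ D := Set.subset_iUnion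
      (fun i => E (s (2 * i)).2 \ E (s (2 * i + 1)).2) i
    have h2 := measureReal_mono (μ := m (s (2 * i + 1)).1) h1
    have h3 := measureReal_sdiff_add_inter (μ := m (s (2 * i + 1)).1) (s := E (s (2 * i)).2)
      (hE (s (2 * i + 1)).2)
    have h4 := measureReal_mono (μ := m (s (2 * i + 1)).1)
      (Set.inter_subset_right (s := E (s (2 * i)).2) (t := E (s (2 * i + 1)).2))
    linarith [hB' (2 * i), hC' (2 * i)]
  have hodd : ∀ i, (m (s (2 * i + 1 + 1)).1).real D ≤ 3 / 10 * δ := fun i => by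
    have h1 : D ⊆ (E j₀ \ E (s (2 * i + 1)).2) ∪ E (s (2 * i + 1 + 1)).2 := by
      refine Set.iUnion_subset fun l => ?_
      rintro x ⟨hx1, hx2⟩
      rcases le_or_gt l i with hl | hl
      · exact Or.inl ⟨hanti (hjge _) hx1,
          fun hx => hx2 (hanti (hJ.monotone (show 2 * l + 1 ≤ 2 * i + 1 by omega)) hx)⟩
      · exact Or.inr (hanti (hJ.monotone (show 2 * i + 1 + 1 ≤ 2 * l by omega)) hx1)
    have h2 := measureReal_mono (μ := m (s (2 * i + 1 + 1)).1) h1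
    have h3 := measureReal_union_le (μ := m (s (2 * i + 1 + 1)).1)
      (E j₀ \ E (s (2 * i + 1)).2) (E (s (2 * i + 1 + 1)).2)
    linarith [hA' (2 * i + 1), hC' (2 * i + 1)]
  have hT1 : Tendsto (fun i => (s (2 * i + 1)).1) atTop atTop :=
    StrictMono.tendsto_atTop fun a b hab => hN (show 2 * a + 1 < 2 * b + 1 by omega)
  have hT2 : Tendsto (fun i => (s (2 * i + 1 + 1)).1) atTop atTop :=
    StrictMono.tendsto_atTop fun a b hab => hN (show 2 * a + 1 + 1 < 2 * b + 1 + 1 by omega)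
  have l1 := ge_of_tendsto ((hlim D hD).comp hT1) (Eventually.of_forall heven)
  have l2 := le_of_tendsto ((hlim D hD).comp hT2) (Eventually.of_forall hodd)
  linarith

/-- A nonnegative finitely additive measure continuous at the empty set is a measure. -/
theorem exists_eq_ofMeasure {μ : Ba X} (hμ : ∀ E, 0 ≤ μ E)
    (hcont : ∀ E : ℕ → Set X, (∀ j, MeasurableSet (E j)) → Antitone E → ⋂ j, E j = ∅ →
      Tendsto (fun j => μ (E j)) atTop (𝓝 0)) :
    ∃ (m : Measure X) (_ : IsFiniteMeasure m), μ = ofMeasure m := by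
  have hsum : ∀ f : ℕ → Set X, (∀ i, MeasurableSet (f i)) →
      Pairwise (Function.onFun Disjoint f) → HasSum (fun i => μ (f i)) (μ (⋃ i, f i)) := by
    intro f hf hd
    rw [hasSum_iff_tendsto_nat_of_nonneg fun i => hμ _]
    have hmeas : ∀ n, MeasurableSet (⋃ i ∈ Finset.range n, f i) := fun n =>
      Finset.measurableSet_biUnion _ fun i _ => hf i
    have h := hcont (fun n => (⋃ i, f i) \ ⋃ i ∈ Finset.range n, f i)
      (fun n => (MeasurableSet.iUnion hf).diff (hmeas n))
      (fun a b hab => Set.sdiff_subset_sdiff_right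
        (Set.biUnion_subset_biUnion_left (Finset.range_mono hab)))
      (by
        refine Set.eq_empty_iff_forall_notMem.2 fun x hx => ?_
        have hx' := Set.mem_iInter.1 hx
        obtain ⟨i, hi⟩ := Set.mem_iUnion.1 (hx' 0).1
        exact (hx' (i + 1)).2 (Set.mem_biUnion (Finset.self_mem_range_succ i) hi))
    have h2 : ∀ n, μ ((⋃ i, f i) \ ⋃ i ∈ Finset.range n, f i) =
        μ (⋃ i, f i) - ∑ i ∈ Finset.range n, μ (f i) := fun n => by
      rw [μ.diff (MeasurableSet.iUnion hf) (hmeas n) (Set.iUnion₂_subset fun i _ =>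
        Set.subset_iUnion f i), μ.biUnion _ f (fun i _ => hf i) (fun i _ j _ hij => hd hij)]
    simp only [h2] at h
    simpa using (h.const_sub (μ (⋃ i, f i)))
  let m : Measure X := Measure.ofMeasurable (fun E _ => ENNReal.ofReal (μ E)) (by simp [μ.empty])
    (fun f hf hd => by
      rw [← (hsum f hf hd).tsum_eq, ENNReal.ofReal_tsum_of_nonneg (fun i => hμ _)
        (hsum f hf hd).summable])
  have hm : ∀ E, MeasurableSet E → m E = ENNReal.ofReal (μ E) := fun E hE =>
    Measure.ofMeasurable_apply E hE
  have hfin : IsFiniteMeasure m := ⟨by rw [hm _ MeasurableSet.univ]; exact ENNReal.ofReal_lt_top⟩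
  refine ⟨m, hfin, Ba.ext fun E hE => ?_⟩
  rw [ofMeasure_apply m hE, Measure.real, hm E hE, ENNReal.toReal_ofReal (hμ E)]

end Nikodym

/-! ### The unique invariant charge is a probability measure -/

section Invariant

variable {X : Type*} [MeasurableSpace X] (p : Kernel X X) [IsMarkovKernel p]

/-- The averaged transition probability as a measure. -/
noncomputable def cesaroMeasure (n : ℕ) (x : X) : Measure X :=
  ENNReal.ofReal (1 / (n : ℝ)) • ∑ k ∈ Finset.Icc 1 n, (p ^ k) x

instance isFiniteMeasure_cesaroMeasure (n : ℕ) (x : X) :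
    IsFiniteMeasure (cesaroMeasure p n x) := by
  unfold cesaroMeasure
  exact Measure.smul_finite _ ENNReal.ofReal_ne_top

theorem cesaroMeasure_real (n : ℕ) (x : X) (E : Set X) :
    (cesaroMeasure p n x).real E = cesaroTransition p n x E := by
  rw [cesaroMeasure, measureReal_ennreal_smul_apply, ENNReal.toReal_ofReal (by positivity),
    cesaroTransition, Measure.real, Measure.finsetSum_apply,
    ENNReal.toReal_sum fun k _ => measure_ne_top _ _]
  rfl

/-- A unique invariant finitely additive probability is a probability measure, and the averaged
transition probabilities converge to it uniformly. -/
theorem exists_invariant_measure (h : linDim (invBa p) = 1) :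
    ∃ (m : Measure X) (_ : IsProbabilityMeasure m), invBa p = {ofMeasure m} ∧ m.bind p = m ∧
      ∀ E, MeasurableSet E → ∀ ε > 0, ∃ N, ∀ n ≥ N, ∀ x,
        |cesaroTransition p n x E - m.real E| < ε := by
  obtain ⟨μ, hμ⟩ := invBa_eq_singleton p h
  have hmem : μ ∈ invBa p := by rw [hμ]; rfl
  have hX : Nonempty X := by
    by_contra hX
    have hX' := not_nonempty_iff.1 hX
    have h1 := hmem.2.1
    rw [Ba.norm_of_nonneg hmem.1, Set.univ_eq_empty_iff.2 hX', μ.empty] at h1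
    exact zero_ne_one h1
  obtain ⟨x⟩ := hX
  have hlim : ∀ E, MeasurableSet E →
      Tendsto (fun n => (cesaroMeasure p n x).real E) atTop (𝓝 (μ E)) := fun E hE => by
    rw [Metric.tendsto_atTop]
    intro ε hε
    obtain ⟨N, hN⟩ := cesaroTransition_tendsto_uniform p hμ hE hε
    refine ⟨N, fun n hn => ?_⟩
    rw [Real.dist_eq, cesaroMeasure_real]
    exact hN n hn x
  -- One starting point `x` is enough here; uniformity in `x` matters only for the absolute
  -- continuity estimates.
  obtain ⟨m, hm, rfl⟩ := exists_eq_ofMeasure hmem.1 fun E hE ha he =>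
    tendsto_zero_of_setwise_limit hmem.1 hlim hE ha he
  have h1 := hmem.2.1
  rw [norm_ofMeasure] at h1
  refine ⟨m, ⟨?_⟩, hμ, ?_, fun E hE ε hε => ?_⟩
  · rw [← ENNReal.toReal_eq_one_iff]
    exact h1
  · have h2 := hmem.2.2
    rw [markovOp_ofMeasure] at h2
    ext E hE
    have h3 := DFunLike.congr_fun h2 E
    rw [ofMeasure_apply _ hE, ofMeasure_apply _ hE] at h3
    exact (measureReal_eq_measureReal_iff).1 h3
  · obtain ⟨N, hN⟩ := cesaroTransition_tendsto_uniform p hμ hE hε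
    refine ⟨N, fun n hn x => ?_⟩
    rw [← ofMeasure_apply m hE]
    exact hN n hn x

end Invariant

/-! ### Uniform absolute continuity with respect to m, and the Doeblin conditions -/

section AbsoluteContinuity

variable {X : Type*} [MeasurableSpace X]

/-- The integrand is at most `a` plus the indicator of `S`. Applied with `m` a transition
probability, this turns a small exceptional set into a pointwise bound. -/
theorem integral_le_add_of_le_off {m : Measure X} [IsProbabilityMeasure m] {f : X → ℝ}
    (hf : Measurable f) (hf0 : ∀ x, 0 ≤ f x) (hf1 : ∀ x, f x ≤ 1) {S : Set X}
    (hS : MeasurableSet S) {a : ℝ} (hfa : ∀ x ∉ S, f x ≤ a) (ha : 0 ≤ a) :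
    ∫ x, f x ∂m ≤ a + m.real S := by
  have hi : Integrable f m := Integrable.of_bound hf.aestronglyMeasurable 1
    (Eventually.of_forall fun x => by rw [Real.norm_of_nonneg (hf0 x)]; exact hf1 x)
  have hi2 : Integrable (S.indicator fun _ => (1 : ℝ)) m :=
    (integrable_const (1 : ℝ)).indicator hS
  calc ∫ x, f x ∂m ≤ ∫ x, (a + S.indicator (fun _ => (1 : ℝ)) x) ∂m := by
        refine integral_mono hi ((integrable_const a).add hi2) fun x => ?_
        by_cases hx : x ∈ S
        · simp only [Set.indicator_of_mem hx]
          linarith [hf1 x]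
        · simp only [Set.indicator_of_notMem hx, add_zero]
          exact hfa x hx
    _ = a + m.real S := by
        rw [integral_add (integrable_const a) hi2, integral_indicator_const _ hS]
        simp

variable (p : Kernel X X)

theorem bind_pow_zero (m : Measure X) : m.bind ⇑(p ^ 0) = m := by
  ext E hE
  rw [Measure.bind_apply hE (p ^ 0).aemeasurable, pow_zero]
  change ∫⁻ x, (Kernel.id x) E ∂m = m E
  simp [Kernel.id_apply, Measure.dirac_apply' _ hE, lintegral_indicator_one hE]

theorem bind_pow_of_invariant {m : Measure X} (hinv : m.bind p = m) (n : ℕ) :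
    m.bind ⇑(p ^ n) = m := by
  induction n with
  | zero => exact bind_pow_zero p m
  | succ n ih =>
    ext E hE
    have h : ∀ x, (p ^ (1 + n)) x E = ∫⁻ y, (p ^ n) y E ∂(p x) := fun x => by
      rw [Kernel.pow_add_apply_eq_lintegral p 1 n x hE, pow_one]
    rw [Measure.bind_apply hE (p ^ (n + 1)).aemeasurable, add_comm n 1]
    simp only [h]
    rw [← Measure.lintegral_bind p.aemeasurable (by
      rw [hinv]; exact ((p ^ n).measurable_coe hE).aemeasurable), hinv,
      ← Measure.bind_apply hE (p ^ n).aemeasurable, ih]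

theorem doeblinCondition_of_exists_pow_le {m : Measure X} [IsProbabilityMeasure m]
    (h : ∃ δ > 0, ∃ n ≥ 1, ∀ E, MeasurableSet E → m.real E < δ →
      ∀ x, ((p ^ n) x).real E ≤ 1 / 2) : DoeblinCondition p := by
  obtain ⟨δ, hδ, n, hn, h⟩ := h
  -- Condition (D) tests `φ E ≤ ε`, so `δ / 2` is needed to get `m.real E < δ` strictly; for (D̃),
  -- where the test is strict, `δ` itself suffices.
  refine ⟨ofMeasure m, ofMeasure_mem_ca m, ofMeasure_nonneg m, min (δ / 2) (1 / 2),
    by positivity, n, hn, fun E hE hEm x => ?_⟩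
  rw [ofMeasure_apply m hE] at hEm
  have h1 := h E hE (by linarith [min_le_left (δ / 2) (1 / 2 : ℝ)]) x
  linarith [min_le_right (δ / 2) (1 / 2 : ℝ)]

theorem averagedDoeblinCondition_of_exists_cesaroTransition_le {m : Measure X}
    [IsProbabilityMeasure m]
    (h : ∃ δ > 0, ∃ n ≥ 1, ∀ E, MeasurableSet E → m.real E < δ →
      ∀ x, cesaroTransition p n x E ≤ 1 / 2) : AveragedDoeblinCondition p := by
  obtain ⟨δ, hδ, n, hn, h⟩ := h
  refine ⟨ofMeasure m, ofMeasure_mem_ca m, ofMeasure_nonneg m, min δ (1 / 2),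
    by positivity, n, hn, fun E hE hEm x => ?_⟩
  rw [ofMeasure_apply m hE] at hEm
  have h1 := h E hE (hEm.trans_le (min_le_left _ _)) x
  linarith [min_le_right δ (1 / 2 : ℝ)]

variable [IsMarkovKernel p]

theorem cesaroTransition_mono (n : ℕ) (x : X) {E F : Set X} (h : E ⊆ F) :
    cesaroTransition p n x E ≤ cesaroTransition p n x F :=
  mul_le_mul_of_nonneg_left (Finset.sum_le_sum fun _ _ => measureReal_mono h) (by positivity)

/-- Otherwise each `n + 1` has a bad set of measure below `η / 4 / 2 ^ n`. The union of these has
measure at most `η / 2`, so uniform convergence on this one set pushes its averages below `η` for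
large index, contradicting monotonicity. -/
theorem exists_cesaroTransition_le {m : Measure X} [IsProbabilityMeasure m]
    (hunif : ∀ E, MeasurableSet E → ∀ ε > 0, ∃ N, ∀ n ≥ N, ∀ x,
      |cesaroTransition p n x E - m.real E| < ε) {η : ℝ} (hη : 0 < η) :
    ∃ δ > 0, ∃ n ≥ 1, ∀ E, MeasurableSet E → m.real E < δ →
      ∀ x, cesaroTransition p n x E ≤ η := by
  by_contra! hcon
  choose E hE hEm x hx using fun n : ℕ =>
    hcon (η / 2 / 2 / 2 ^ n) (by positivity) (n + 1) (by omega)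
  have hS : m.real (⋃ n, E n) ≤ η / 2 := by
    rw [Measure.real]
    refine ENNReal.toReal_le_of_le_ofReal (by positivity) ?_
    rw [← tsum_geometric_two' (η / 2), ENNReal.ofReal_tsum_of_nonneg (fun n => by positivity)
      (summable_geometric_two' (η / 2))]
    refine (measure_iUnion_le _).trans (ENNReal.tsum_le_tsum fun n => ?_)
    rw [ENNReal.le_ofReal_iff_toReal_le (measure_ne_top _ _) (by positivity)]
    exact (hEm n).le
  obtain ⟨N, hN⟩ := hunif _ (MeasurableSet.iUnion hE) (η / 2) (by positivity)
  have h1 := (abs_lt.1 (hN (N + 1) (by omega) (x N))).2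
  have h2 := cesaroTransition_mono p (N + 1) (x N) (Set.subset_iUnion E N)
  linarith [hx N]

/-- Sets of small invariant measure have uniformly small `n`-step transition probability. -/
theorem exists_pow_le {m : Measure X} [IsProbabilityMeasure m] (hinv : m.bind p = m)
    (hunif : ∀ E, MeasurableSet E → ∀ ε > 0, ∃ N, ∀ n ≥ N, ∀ x,
      |cesaroTransition p n x E - m.real E| < ε) {η : ℝ} (hη : 0 < η) :
    ∃ δ > 0, ∃ n ≥ 1, ∀ E, MeasurableSet E → m.real E < δ →
      ∀ x, ((p ^ n) x).real E ≤ η := by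
  obtain ⟨δ, hδ, n, hn, h⟩ := exists_cesaroTransition_le p hunif (half_pos hη)
  have hn0 : (0 : ℝ) < n := by exact_mod_cast hn
  -- The bound is chosen so that `n` applications of Markov's inequality at level `η / 2` add up to
  -- less than `δ`.
  refine ⟨δ * (η / 2) / n, by positivity, n, hn, fun E hE hEm x => ?_⟩
  -- `S j` holds the states from which `E` is still likely after the remaining `n - j` steps;
  -- invariance of `m` bounds its measure by `m.real E / (η / 2)`. The average over `j` of the
  -- chance of being in the union at time `j` is at most `η / 2`, so some `j` does as well, and
  -- splitting `p ^ n` at that time gives `η / 2 + η / 2`. Since `j` depends on `x`, the union over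
  -- all `j` is needed.
  let S : ℕ → Set X := fun j => {y | η / 2 ≤ ((p ^ (n - j)) y).real E}
  have hSm : ∀ j, MeasurableSet (S j) := fun j =>
    measurableSet_le measurable_const (measurable_measureReal (p ^ (n - j)) hE)
  have hS : ∀ j, m.real (S j) ≤ m.real E / (η / 2) := fun j => by
    rw [le_div_iff₀ (half_pos hη), mul_comm]
    have h1 := mul_meas_ge_le_integral_of_nonneg (μ := m)
      (f := fun y => ((p ^ (n - j)) y).real E) (Eventually.of_forall fun y => measureReal_nonneg)
      (Integrable.of_bound (measurable_measureReal (p ^ (n - j)) hE).aestronglyMeasurable 1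
        (Eventually.of_forall fun y => abs_measureReal_le_one (p ^ (n - j)) E y)) (η / 2)
    rwa [← real_bind_eq_integral m (p ^ (n - j)) hE, bind_pow_of_invariant p hinv] at h1
  have hT : m.real (⋃ j ∈ Finset.Icc 1 n, S j) < δ := by
    calc m.real (⋃ j ∈ Finset.Icc 1 n, S j) ≤ ∑ j ∈ Finset.Icc 1 n, m.real (S j) :=
          measureReal_biUnion_finset_le _ _
      _ ≤ ∑ j ∈ Finset.Icc 1 n, m.real E / (η / 2) := Finset.sum_le_sum fun j _ => hS j
      _ = n * m.real E / (η / 2) := by simp; ring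
      _ < δ := by
        rw [lt_div_iff₀ hn0] at hEm
        rw [div_lt_iff₀ (half_pos hη)]
        linarith
  have h2 := h _ (Finset.measurableSet_biUnion _ fun j _ => hSm j) hT x
  obtain ⟨j, hj, hjle⟩ : ∃ j ∈ Finset.Icc 1 n,
      ((p ^ j) x).real (⋃ j ∈ Finset.Icc 1 n, S j) ≤ η / 2 := by
    refine Finset.exists_le_of_sum_le (Finset.nonempty_Icc.2 hn) ?_
    rw [cesaroTransition, one_div, inv_mul_le_iff₀ hn0] at h2
    simpa using h2
  have hjn : j + (n - j) = n := Nat.add_sub_cancel' (Finset.mem_Icc.1 hj).2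
  have h3 := real_pow_add_eq_integral p j (n - j) x hE
  rw [hjn] at h3
  rw [h3]
  have h4 := integral_le_add_of_le_off (m := (p ^ j) x)
    (measurable_measureReal (p ^ (n - j)) hE) (fun y => measureReal_nonneg)
    (fun y => measureReal_le_one) (Finset.measurableSet_biUnion _ fun j _ => hSm j)
    (a := η / 2) (S := ⋃ j ∈ Finset.Icc 1 n, S j) (fun y hy => by
      by_contra hcon
      exact hy (Set.mem_biUnion hj (le_of_not_ge hcon))) (half_pos hη).le
  linarith

end AbsoluteContinuity

/-! ### Approximating a kernel in L¹ by functions constant on finitely many cells -/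

section ProductApproximation

theorem preimage_prodMk_singleton {X ι κ : Type*} (c : X → ι) (d : X → κ) (q : ι × κ) :
    (fun x => (c x, d x)) ⁻¹' {q} = c ⁻¹' {q.1} ∩ d ⁻¹' {q.2} := by
  ext x
  simp [Prod.ext_iff]

variable {X : Type*} [MeasurableSpace X]

/-- The sets in `X × X` whose sections over the first factor are constant on the cells of a finite
measurable partition. -/
def steppedSets (X : Type*) [MeasurableSpace X] : Set (Set (X × X)) :=
  {D | ∃ (ι : Type) (_ : Fintype ι) (c : X → ι) (F : ι → Set X),
    (∀ i, MeasurableSet (c ⁻¹' {i})) ∧ (∀ i, MeasurableSet (F i)) ∧ D = {z | z.2 ∈ F (c z.1)}}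

/-- The functions on `X × X` whose sections over the first factor are constant on the cells of a
finite measurable partition. -/
def IsStepped (f : X × X → ℝ) : Prop :=
  ∃ (ι : Type) (_ : Fintype ι) (c : X → ι) (h : ι → X → ℝ),
    (∀ i, MeasurableSet (c ⁻¹' {i})) ∧ (∀ i, Measurable (h i)) ∧ f = fun z => h (c z.1) z.2

/-- The common refinement of the two partitions, indexed by `ι × κ`, carries both sets. -/
theorem isSetRing_steppedSets : IsSetRing (steppedSets X) where
  empty_mem := ⟨Unit, inferInstance, fun _ => (), fun _ => ∅, fun _ => by simp, fun _ => by simp,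
    by simp⟩
  union_mem := by
    rintro _ _ ⟨ι, _, c, F, hc, hF, rfl⟩ ⟨κ, _, d, G, hd, hG, rfl⟩
    refine ⟨ι × κ, inferInstance, fun x => (c x, d x), fun q => F q.1 ∪ G q.2, fun q => ?_,
      fun q => (hF _).union (hG _), rfl⟩
    rw [preimage_prodMk_singleton]
    exact (hc _).inter (hd _)
  sdiff_mem := by
    rintro _ _ ⟨ι, _, c, F, hc, hF, rfl⟩ ⟨κ, _, d, G, hd, hG, rfl⟩
    refine ⟨ι × κ, inferInstance, fun x => (c x, d x), fun q => F q.1 \ G q.2, fun q => ?_,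
      fun q => (hF _).diff (hG _), rfl⟩
    rw [preimage_prodMk_singleton]
    exact (hc _).inter (hd _)

theorem IsStepped.add {f g : X × X → ℝ} (hf : IsStepped f) (hg : IsStepped g) :
    IsStepped (f + g) := by
  obtain ⟨ι, _, c, h, hc, hh, rfl⟩ := hf
  obtain ⟨κ, _, d, k, hd, hk, rfl⟩ := hg
  refine ⟨ι × κ, inferInstance, fun x => (c x, d x), fun q => h q.1 + k q.2, fun q => ?_,
    fun q => (hh _).add (hk _), rfl⟩
  rw [preimage_prodMk_singleton]
  exact (hc _).inter (hd _)

theorem IsStepped.measurable {f : X × X → ℝ} (hf : IsStepped f) : Measurable f := by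
  obtain ⟨ι, _, c, h, hc, hh, rfl⟩ := hf
  let _ : MeasurableSpace ι := ⊤
  have hcm : Measurable c := measurable_to_countable' hc
  have h1 : Measurable fun q : ι × X => h q.1 q.2 := measurable_from_prod_countable_right hh
  exact h1.comp ((hcm.comp measurable_fst).prodMk measurable_snd)

theorem isStepped_indicator {D : Set (X × X)} (hD : D ∈ steppedSets X) (a : ℝ) :
    IsStepped (D.indicator fun _ => a) := by
  obtain ⟨ι, _, c, F, hc, hF, rfl⟩ := hD
  exact ⟨ι, inferInstance, c, fun i => (F i).indicator fun _ => a, hc,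
    fun i => measurable_const.indicator (hF i), rfl⟩

theorem measurableSet_of_mem_steppedSets {D : Set (X × X)} (hD : D ∈ steppedSets X) :
    MeasurableSet D := by
  rw [← measurable_indicator_const_iff (1 : ℝ)]
  exact (isStepped_indicator hD 1).measurable

theorem prod_mem_steppedSets {A B : Set X} (hA : MeasurableSet A) (hB : MeasurableSet B) :
    A ×ˢ B ∈ steppedSets X := by
  classical
  refine ⟨Bool, inferInstance, fun x => decide (x ∈ A), fun b => if b then B else ∅,
    fun b => ?_, fun b => ?_, ?_⟩
  · cases b
    · convert hA.compl using 1
      ext x; simp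
    · convert hA using 1
      ext x; simp
  · cases b <;> simp [hB]
  · ext ⟨x, y⟩
    by_cases hx : x ∈ A <;> simp [hx]

/-- Measurable rectangles are stepped. A ring that generates the σ-algebra approximates every
measurable set in measure, which gives density in L¹. -/
theorem generateFrom_steppedSets :
    (Prod.instMeasurableSpace : MeasurableSpace (X × X)) =
      MeasurableSpace.generateFrom (steppedSets X) := by
  refine le_antisymm ?_ (MeasurableSpace.generateFrom_le fun D => measurableSet_of_mem_steppedSets)
  rw [← generateFrom_prod]
  refine MeasurableSpace.generateFrom_mono ?_
  rintro _ ⟨A, hA, B, hB, rfl⟩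
  exact prod_mem_steppedSets hA hB

/-- Stepped functions are dense in `L¹` of a finite measure on `X × X`. -/
theorem exists_isStepped_integral_le {M : Measure (X × X)} [IsFiniteMeasure M] {k : X × X → ℝ}
    (hk : Integrable k M) {ε : ℝ} (hε : 0 < ε) :
    ∃ g, IsStepped g ∧ Integrable g M ∧ ∫ z, |k z - g z| ∂M ≤ ε := by
  obtain ⟨g, hg, hgs⟩ := (memLp_one_iff_integrable.2 hk).induction_dense (p := 1) (μ := M)
    ENNReal.one_ne_top IsStepped (fun a s hs _ ε hε => by
      -- The `+ 1` covers `a = 0`.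
      have hpos : 0 < ε / (‖a‖ₑ + 1) := ENNReal.div_pos hε (by simp)
      obtain ⟨D, hD, hDs⟩ := exists_measure_symmDiff_lt_of_generateFrom_isSetRing (μ := M)
        isSetRing_steppedSets ⟨{Set.univ}, Set.countable_singleton _, by
          rw [Set.singleton_subset_iff, ← Set.univ_prod_univ]
          exact prod_mem_steppedSets MeasurableSet.univ MeasurableSet.univ, by simp⟩
        generateFrom_steppedSets hs hpos
      refine ⟨_, ?_, isStepped_indicator hD a⟩
      have hDm := measurableSet_of_mem_steppedSets hD
      rw [eLpNorm_one_eq_lintegral_enorm]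
      calc ∫⁻ z, ‖(D.indicator (fun _ => a) - s.indicator fun _ => a) z‖ₑ ∂M
          = ∫⁻ z, (symmDiff D s).indicator (fun _ => ‖a‖ₑ) z ∂M := by
            refine lintegral_congr fun z => ?_
            by_cases h1 : z ∈ D <;> by_cases h2 : z ∈ s <;>
              simp [h1, h2, Set.mem_symmDiff, Set.indicator]
        _ = ‖a‖ₑ * M (symmDiff D s) := lintegral_indicator_const (hDm.symmDiff hs) _
        _ ≤ (‖a‖ₑ + 1) * (ε / (‖a‖ₑ + 1)) := by
            gcongr
            exact le_self_add
        _ = ε := ENNReal.mul_div_cancel (by simp) (by simp))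
    (fun f g hf hg => hf.add hg) (fun f hf => hf.measurable.aestronglyMeasurable)
    (ε := ENNReal.ofReal ε) (by simpa using hε)
  have hkg : MemLp (k - g) 1 M :=
    ⟨hk.aestronglyMeasurable.sub hgs.measurable.aestronglyMeasurable,
      hg.trans_lt ENNReal.ofReal_lt_top⟩
  have hgi : Integrable g M := by
    have := hk.sub (memLp_one_iff_integrable.1 hkg)
    rwa [sub_sub_cancel] at this
  refine ⟨g, hgs, hgi, ?_⟩
  have h1 := integral_norm_eq_lintegral_enorm hkg.1
  rw [← eLpNorm_one_eq_lintegral_enorm] at h1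
  calc ∫ z, |k z - g z| ∂M = (eLpNorm (k - g) 1 M).toReal := h1
    _ ≤ ε := ENNReal.toReal_le_of_le_ofReal hε.le hg

/-- Test on `{f ≥ 0}` and on its complement. An L¹ bound on the sections thereby reduces to
comparing masses of rectangles `A ×ˢ E`. -/
theorem integral_abs_le_of_abs_setIntegral_le {m : Measure X} {f : X → ℝ} (hfm : Measurable f)
    (hf : Integrable f m) {a : ℝ} (h : ∀ A, MeasurableSet A → |∫ x in A, f x ∂m| ≤ a) :
    ∫ x, |f x| ∂m ≤ 2 * a := by
  have hA : MeasurableSet {x | 0 ≤ f x} := measurableSet_le measurable_const hfm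
  rw [← integral_add_compl hA hf.abs]
  have e1 : ∫ x in {x | 0 ≤ f x}, |f x| ∂m = ∫ x in {x | 0 ≤ f x}, f x ∂m :=
    setIntegral_congr_fun hA fun x hx => abs_of_nonneg hx
  have e2 : ∫ x in {x | 0 ≤ f x}ᶜ, |f x| ∂m = -∫ x in {x | 0 ≤ f x}ᶜ, f x ∂m := by
    rw [← integral_neg]
    exact setIntegral_congr_fun hA.compl fun x hx => abs_of_neg (not_le.1 hx)
  rw [e1, e2]
  linarith [(abs_le.1 (h _ hA)).2, (abs_le.1 (h _ hA.compl)).1]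

/-- If `κ(x, ·)` is absolutely continuous up to an error `η`, then all functions `κ(·, E)` are
`L¹`-close to functions which are constant on the cells of one finite partition. -/
theorem exists_partition_integral_le {m : Measure X} [IsProbabilityMeasure m] (κ : Kernel X X)
    [IsMarkovKernel κ] {η : ℝ} (hη : 0 < η)
    (hκ : ∀ E, MeasurableSet E → m E = 0 → ∀ x, (κ x).real E ≤ η) :
    ∃ (ι : Type) (_ : Fintype ι) (c : X → ι), (∀ i, MeasurableSet (c ⁻¹' {i})) ∧
      ∀ E, MeasurableSet E → ∃ a : ι → ℝ, ∫ x, |(κ x).real E - a (c x)| ∂m ≤ 4 * η := by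
  -- The σ-algebra need not be countably generated, so instead of choosing densities of `κ x`
  -- jointly measurably in `x`, the joint law is decomposed on the product. `N` is `M`-null and
  -- carries the singular part; almost all its sections are `m`-null, hence `Θ.real N ≤ η`.
  let Θ : Measure (X × X) := m ⊗ₘ κ
  let M : Measure (X × X) := m.prod m
  have hsing := Measure.mutuallySingular_singularPart Θ M
  let N : Set (X × X) := hsing.nullSetᶜ
  have hN : MeasurableSet N := hsing.measurableSet_nullSet.compl
  have hMN : M N = 0 := hsing.measure_compl_nullSet
  have hΘN : Θ.real N ≤ η := by
    have h1 := (Measure.measure_prod_null hN).1 hMN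
    refine ENNReal.toReal_le_of_le_ofReal hη.le ?_
    rw [Measure.compProd_apply hN]
    calc ∫⁻ x, κ x (Prod.mk x ⁻¹' N) ∂m ≤ ∫⁻ _, ENNReal.ofReal η ∂m := by
          refine lintegral_mono_ae ?_
          filter_upwards [h1] with x hx
          rw [ENNReal.le_ofReal_iff_toReal_le (measure_ne_top _ _) hη.le]
          exact hκ _ (measurable_prodMk_left hN) hx x
      _ = ENNReal.ofReal η := by simp
  have hac : Θ.restrict Nᶜ ≪ M := by
    refine Measure.AbsolutelyContinuous.mk fun s hs hs0 => ?_
    rw [Measure.restrict_apply hs, Measure.haveLebesgueDecomposition_add Θ M,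
      Measure.add_apply, add_eq_zero]
    refine ⟨measure_mono_null Set.inter_subset_right ?_,
      measure_mono_null Set.inter_subset_left (withDensity_absolutelyContinuous _ _ hs0)⟩
    rw [compl_compl]
    exact hsing.measure_nullSet
  let k : X × X → ℝ := fun z => ((Θ.restrict Nᶜ).rnDeriv M z).toReal
  have hki : Integrable k M := Measure.integrable_toReal_rnDeriv
  obtain ⟨g, hg, hgi, hkg⟩ := exists_isStepped_integral_le hki hη
  have hgm := hg.measurable
  obtain ⟨ι, hι, c, h, hc, hh, rfl⟩ := hg
  -- The partition comes from the density alone; only the values on its cells depend on `E`.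
  refine ⟨ι, hι, c, hc, fun E hE => ⟨fun i => ∫ y in E, h i y ∂m, ?_⟩⟩
  let _ : MeasurableSpace ι := ⊤
  have hcm : Measurable c := measurable_to_countable' hc
  have hfm : Measurable fun x => (κ x).real E - ∫ y in E, h (c x) y ∂m :=
    (measurable_measureReal κ hE).sub ((measurable_from_top (f := fun i => ∫ y in E, h i y ∂m)).comp
      hcm)
  have hκi : Integrable (fun x => (κ x).real E) m :=
    Integrable.of_bound (measurable_measureReal κ hE).aestronglyMeasurable 1
      (Eventually.of_forall fun x => abs_measureReal_le_one κ E x)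
  have hhi : Integrable (fun x => ∫ y in E, h (c x) y ∂m) m := by
    have h1 : Integrable (fun z : X × X => h (c z.1) z.2) (m.prod (m.restrict E)) :=
      hgi.mono_measure (Measure.prod_mono le_rfl Measure.restrict_le_self)
    exact h1.integral_prod_left
  -- On each rectangle, one `η` is lost to `N` and one to the stepped approximation of the density;
  -- testing on sets doubles the sum.
  have h4 : 4 * η = 2 * (2 * η) := by ring
  rw [h4]
  refine integral_abs_le_of_abs_setIntegral_le hfm (hκi.sub hhi) fun A hA => ?_
  have hAE : MeasurableSet (A ×ˢ E) := hA.prod hE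
  have e1 : ∫ x in A, (κ x).real E ∂m = Θ.real (A ×ˢ E) := by
    rw [Measure.real, Measure.compProd_apply_prod hA hE]
    simp only [Measure.real]
    rw [integral_toReal (κ.measurable_coe hE).aemeasurable
      (Eventually.of_forall fun x => measure_lt_top _ _)]
  have e2 : ∫ x in A, ∫ y in E, h (c x) y ∂m ∂m = ∫ z in A ×ˢ E, h (c z.1) z.2 ∂M :=
    (setIntegral_prod (fun z : X × X => h (c z.1) z.2) hgi.integrableOn).symm
  have e3 : ∫ z in A ×ˢ E, k z ∂M = Θ.real (A ×ˢ E \ N) := by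
    rw [Measure.setIntegral_toReal_rnDeriv hac, measureReal_restrict_apply hAE, Set.sdiff_eq]
  have e4 := measureReal_sdiff_add_inter (μ := Θ) (s := A ×ˢ E) hN
  have e5 : Θ.real (A ×ˢ E ∩ N) ≤ η := (measureReal_mono Set.inter_subset_right).trans hΘN
  have e6 : |∫ z in A ×ˢ E, k z ∂M - ∫ z in A ×ˢ E, h (c z.1) z.2 ∂M| ≤ η := by
    rw [← integral_sub hki.integrableOn hgi.integrableOn]
    refine (abs_integral_le_integral_abs).trans (le_trans ?_ hkg)
    exact setIntegral_le_integral (hki.sub hgi).abs (Eventually.of_forall fun z => abs_nonneg _)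
  rw [integral_sub hκi.integrableOn hhi.integrableOn, e1, e2]
  have e7 : 0 ≤ Θ.real (A ×ˢ E ∩ N) := measureReal_nonneg
  have e8 := abs_le.1 e6
  rw [abs_le]
  constructor <;> linarith

theorem integral_eq_sum_fiber {ι : Type*} [Fintype ι] {m : Measure X} {c : X → ι}
    (hc : ∀ i, MeasurableSet (c ⁻¹' {i})) {f : X → ℝ} (hf : Integrable f m) :
    ∫ x, f x ∂m = ∑ i, ∫ x in c ⁻¹' {i}, f x ∂m := by
  rw [← integral_iUnion_fintype hc (fun i j hij => Disjoint.preimage _ (by simpa using hij))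
    fun i => hf.integrableOn]
  have : ⋃ i, c ⁻¹' {i} = Set.univ := Set.eq_univ_of_forall fun x => Set.mem_iUnion.2 ⟨c x, rfl⟩
  rw [this, setIntegral_univ]

/-- Replacing the values on the cells of a partition by the averages at most doubles the
`L¹`-distance. -/
theorem integral_abs_sub_average_le {ι : Type*} [Fintype ι] {m : Measure X} [IsFiniteMeasure m]
    {c : X → ι} (hc : ∀ i, MeasurableSet (c ⁻¹' {i})) {f : X → ℝ} (hf : Integrable f m)
    (a : ι → ℝ) :
    ∫ x, |f x - (∫ y in c ⁻¹' {c x}, f y ∂m) / m.real (c ⁻¹' {c x})| ∂m ≤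
      2 * ∫ x, |f x - a (c x)| ∂m := by
  let _ : MeasurableSpace ι := ⊤
  have hcm : Measurable c := measurable_to_countable' hc
  have hint : ∀ b : ι → ℝ, Integrable (fun x => b (c x)) m := fun b => by
    refine Integrable.of_bound
      ((measurable_from_top (f := b)).comp hcm).aestronglyMeasurable (∑ i, |b i|)
      (Eventually.of_forall fun x => ?_)
    exact Finset.single_le_sum (f := fun i => |b i|) (fun i _ => abs_nonneg _) (Finset.mem_univ _)
  have hi : ∀ b : ι → ℝ, Integrable (fun x => |f x - b (c x)|) m := fun b =>
    (hf.sub (hint b)).abs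
  have hcongr : ∀ (b : ι → ℝ) (i : ι), ∫ x in c ⁻¹' {i}, |f x - b (c x)| ∂m =
      ∫ x in c ⁻¹' {i}, |f x - b i| ∂m := fun b i =>
    setIntegral_congr_fun (hc i) fun x hx => by
      have : c x = i := hx
      simp only [this]
  rw [integral_eq_sum_fiber hc
    (hi fun i => (∫ y in c ⁻¹' {i}, f y ∂m) / m.real (c ⁻¹' {i})), integral_eq_sum_fiber hc (hi a),
    Finset.mul_sum]
  refine Finset.sum_le_sum fun i _ => ?_
  rw [hcongr a, hcongr fun i => (∫ y in c ⁻¹' {i}, f y ∂m) / m.real (c ⁻¹' {i})]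
  set r := (∫ y in c ⁻¹' {i}, f y ∂m) / m.real (c ⁻¹' {i}) with hr
  have hfi : IntegrableOn f (c ⁻¹' {i}) m := hf.integrableOn
  have hic : ∀ b : ℝ, IntegrableOn (fun _ => b) (c ⁻¹' {i}) m := fun b =>
    (integrable_const b).integrableOn
  -- On a cell of positive measure, the left side is the absolute value of the integral of `f - a i`
  -- over the cell. On a null cell, where `r` is 0 by the division convention, it vanishes.
  have h1 : m.real (c ⁻¹' {i}) * |a i - r| ≤ ∫ x in c ⁻¹' {i}, |f x - a i| ∂m := by
    rcases eq_or_ne (m.real (c ⁻¹' {i})) 0 with h0 | h0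
    · rw [h0, zero_mul]
      exact integral_nonneg fun x => abs_nonneg _
    · have h2 : m.real (c ⁻¹' {i}) * (a i - r) = -∫ x in c ⁻¹' {i}, (f x - a i) ∂m := by
        rw [integral_sub hfi (hic _), setIntegral_const, smul_eq_mul, mul_sub, hr,
          mul_div_cancel₀ _ h0]
        ring
      calc m.real (c ⁻¹' {i}) * |a i - r| = |m.real (c ⁻¹' {i}) * (a i - r)| := by
            rw [abs_mul, abs_of_nonneg measureReal_nonneg]
        _ ≤ _ := by
            rw [h2, abs_neg]
            exact abs_integral_le_integral_abs
  calc ∫ x in c ⁻¹' {i}, |f x - r| ∂m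
      ≤ ∫ x in c ⁻¹' {i}, (|f x - a i| + |a i - r|) ∂m := by
        refine integral_mono ((hfi.sub (hic r)).abs)
          (((hfi.sub (hic (a i))).abs).add (hic _)) fun x => ?_
        exact abs_sub_le _ _ _
    _ = ∫ x in c ⁻¹' {i}, |f x - a i| ∂m + m.real (c ⁻¹' {i}) * |a i - r| := by
        have h3 : IntegrableOn (fun x => |f x - a i|) (c ⁻¹' {i}) m := (hfi.sub (hic (a i))).abs
        rw [integral_add h3 (hic _), setIntegral_const, smul_eq_mul]
    _ ≤ 2 * ∫ x in c ⁻¹' {i}, |f x - a i| ∂m := by linarith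

end ProductApproximation

/-! ### Finite-rank approximation of a power of the Markov operator -/

section Quasicompact

variable {X : Type*} [MeasurableSpace X]

/-- Evaluation at a set as a continuous linear functional on `ca(X, Σ)`. -/
noncomputable def evalCa (E : Set X) : ca X →L[ℝ] ℝ where
  toFun ν := (ν : Ba X) E
  map_add' _ _ := rfl
  map_smul' _ _ := rfl
  cont := (Ba.continuous_eval E).comp continuous_subtype_val

theorem isCompactOperator_smulRight {V W : Type*} [NormedAddCommGroup V] [NormedSpace ℝ V]
    [NormedAddCommGroup W] [NormedSpace ℝ W] (φ : V →L[ℝ] ℝ) (w : W) :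
    IsCompactOperator (φ.smulRight w) := by
  have h : IsCompactOperator (id : ℝ → ℝ) :=
    (isCompactOperator_id_iff_finiteDimensional (𝕜 := ℝ)).2 inferInstance
  exact (h.comp_clm φ).clm_comp (ContinuousLinearMap.toSpanSingleton ℝ w)

theorem isCompactOperator_sum {ι V W : Type*} [NormedAddCommGroup V] [NormedSpace ℝ V]
    [NormedAddCommGroup W] [NormedSpace ℝ W] (s : Finset ι) (T : ι → V →L[ℝ] W)
    (hT : ∀ i ∈ s, IsCompactOperator (T i)) :
    IsCompactOperator (∑ i ∈ s, T i : V →L[ℝ] W) := by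
  classical
  induction s using Finset.induction_on with
  | empty => simpa using isCompactOperator_zero
  | insert a s ha ih =>
    rw [Finset.sum_insert ha]
    exact (hT a (by simp)).add (ih fun i hi => hT i (by simp [hi]))

variable (p : Kernel X X) [IsMarkovKernel p]

theorem coe_markovOpCa_pow (n : ℕ) (ν : ca X) :
    ((markovOpCa p ^ n) ν : Ba X) = (markovOp p ^ n) (ν : Ba X) := by
  induction n with
  | zero => rfl
  | succ n ih =>
    rw [pow_succ', pow_succ']
    change markovOp p ((markovOpCa p ^ n) ν : Ba X) = markovOp p ((markovOp p ^ n) (ν : Ba X))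
    rw [ih]

theorem markovOp_pow_ofMeasure (n : ℕ) (m : Measure X) [IsFiniteMeasure m] :
    (markovOp p ^ n) (ofMeasure m) = ofMeasure (m.bind ⇑(p ^ n)) := by
  induction n with
  | zero =>
    refine Ba.ext fun E hE => ?_
    change ofMeasure m E = _
    rw [ofMeasure_apply _ hE, ofMeasure_apply _ hE]
    simp only [Measure.real]
    rw [bind_pow_zero]
  | succ n ih =>
    rw [pow_succ']
    change markovOp p ((markovOp p ^ n) (ofMeasure m)) = _
    rw [ih, markovOp_ofMeasure]
    refine Ba.ext fun E hE => ?_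
    rw [ofMeasure_apply _ hE, ofMeasure_apply _ hE]
    simp only [Measure.real]
    rw [Measure.bind_bind (p ^ n).aemeasurable p.aemeasurable]
    simp only [bind_pow_succ]

theorem markovOp_pow_ofMeasure_apply (n : ℕ) (m : Measure X) [IsFiniteMeasure m] {E : Set X}
    (hE : MeasurableSet E) :
    (markovOp p ^ n) (ofMeasure m) E = ∫ x, ((p ^ n) x).real E ∂m := by
  rw [markovOp_pow_ofMeasure, ofMeasure_apply _ hE, real_bind_eq_integral m (p ^ n) hE]

/-- If the functions `p^l(·, E)` are uniformly close in `L¹(m)` to their averages over the cells of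
one finite partition, and `p^n` is uniformly absolutely continuous, then `A^(n+l)` is close to an
operator of finite rank. -/
theorem quasicompactCondition_of_partition {m : Measure X} [IsProbabilityMeasure m] {δ : ℝ} {n l : ℕ}
    (hn : 1 ≤ n)
    (hac : ∀ E, MeasurableSet E → m.real E < δ → ∀ x, ((p ^ n) x).real E ≤ 1 / 32)
    {ι : Type*} [Fintype ι] {c : X → ι} (hc : ∀ i, MeasurableSet (c ⁻¹' {i}))
    (hl : ∀ E, MeasurableSet E → ∫ x, |((p ^ l) x).real E -
      (∫ y in c ⁻¹' {c x}, ((p ^ l) y).real E ∂m) / m.real (c ⁻¹' {c x})| ∂m < δ / 32) :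
    QuasicompactCondition p := by
  let _ : MeasurableSpace ι := ⊤
  have hcm : Measurable c := measurable_to_countable' hc
  -- The law of the chain after `l` steps when started from `m` conditioned on cell `i` (zero on a
  -- null cell). Cell averages are used because they are countably additive in `E` and lie in [0,
  -- 1].
  let w : ι → ca X := fun i => (m.real (c ⁻¹' {i}))⁻¹ •
    ⟨ofMeasure ((m.restrict (c ⁻¹' {i})).bind ⇑(p ^ l)), ofMeasure_mem_ca _⟩
  have hw : ∀ i E, MeasurableSet E → (w i : Ba X) E =
      (∫ y in c ⁻¹' {i}, ((p ^ l) y).real E ∂m) / m.real (c ⁻¹' {i}) := fun i E hE => by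
    rw [div_eq_inv_mul, ← real_bind_eq_integral _ (p ^ l) hE, ← ofMeasure_apply _ hE]
    rfl
  have hmeas : ∀ (j : ℕ) (E : Set X), MeasurableSet E →
      Measurable fun x => ((p ^ j) x).real E := fun j E hE => measurable_measureReal (p ^ j) hE
  have hint : ∀ (j : ℕ) (E : Set X) (ρ : Measure X) [IsFiniteMeasure ρ], MeasurableSet E →
      Integrable (fun x => ((p ^ j) x).real E) ρ := fun j E ρ _ hE =>
    Integrable.of_bound (hmeas j E hE).aestronglyMeasurable 1
      (Eventually.of_forall fun x => abs_measureReal_le_one (p ^ j) E x)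
  -- Run `n` steps, keep only the masses of the cells, and continue from each cell with its average
  -- law `w i`: an operator of finite rank.
  let B : ca X →L[ℝ] ca X :=
    ∑ i, ((evalCa (c ⁻¹' {i})).comp (markovOpCa p ^ n)).smulRight (w i)
  refine ⟨B, n + l, isCompactOperator_sum _ _ fun i _ => isCompactOperator_smulRight _ _,
    by omega, ?_⟩
  have hB : ∀ (ν : ca X) (E : Set X), (B ν : Ba X) E =
      ∑ i, (markovOp p ^ n) (ν : Ba X) (c ⁻¹' {i}) * (w i : Ba X) E := fun ν E => by
    rw [_root_.sum_apply, Submodule.coe_sum, Ba.sum_apply]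
    refine Finset.sum_congr rfl fun i _ => ?_
    rw [← coe_markovOpCa_pow]
    rfl
  refine lt_of_le_of_lt (ContinuousLinearMap.opNorm_le_bound _
    (by norm_num : (0 : ℝ) ≤ 1 / 8) fun ν => ?_) (by norm_num : (1 / 8 : ℝ) < 1)
  -- The total variation is at most twice the supremum over sets, so it suffices to bound each set
  -- by `1 / 16`.
  have h2 : (1 / 8 : ℝ) * ‖ν‖ = 2 * (1 / 16 * ‖(ν : Ba X)‖) := by
    rw [Submodule.coe_norm]; ring
  rw [h2]
  refine Ba.norm_le_two_mul _ fun E hE => ?_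
  let r : ι → ℝ := fun i => (w i : Ba X) E
  let u : X → ℝ := fun y => ((p ^ l) y).real E - r (c y)
  have hrm : Measurable fun y => r (c y) := (measurable_from_top (f := r)).comp hcm
  have hum : Measurable u := (hmeas l E hE).sub hrm
  have hr0 : ∀ i, 0 ≤ r i := fun i => by
    change 0 ≤ (w i : Ba X) E
    rw [hw i E hE]
    exact div_nonneg (integral_nonneg fun _ => measureReal_nonneg) measureReal_nonneg
  have hr1 : ∀ i, r i ≤ 1 := fun i => by
    change (w i : Ba X) E ≤ 1
    rw [hw i E hE]
    refine div_le_one_of_le₀ ?_ measureReal_nonneg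
    calc ∫ y in c ⁻¹' {i}, ((p ^ l) y).real E ∂m ≤ ∫ _ in c ⁻¹' {i}, (1 : ℝ) ∂m :=
          integral_mono (hint l E _ hE) (integrable_const _) fun y => measureReal_le_one
      _ = m.real (c ⁻¹' {i}) := by simp
  have hu1 : ∀ y, |u y| ≤ 1 := fun y => by
    have h3 : ((p ^ l) y).real E ≤ 1 := measureReal_le_one
    have h4 : 0 ≤ ((p ^ l) y).real E := measureReal_nonneg
    rw [abs_le]
    constructor
    · change -1 ≤ ((p ^ l) y).real E - r (c y)
      linarith [hr1 (c y)]
    · change ((p ^ l) y).real E - r (c y) ≤ 1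
      linarith [hr0 (c y)]
  have hrint : ∀ (ρ : Measure X) [IsFiniteMeasure ρ], Integrable (fun y => r (c y)) ρ :=
    fun ρ _ => Integrable.of_bound hrm.aestronglyMeasurable 1 (Eventually.of_forall fun y => by
      rw [Real.norm_of_nonneg (hr0 _)]; exact hr1 _)
  have huint : ∀ (ρ : Measure X) [IsFiniteMeasure ρ], Integrable u ρ := fun ρ _ =>
    (hint l E ρ hE).sub (hrint ρ)
  -- Integrating `f` against `ν` gives `(A^(n+l) - B) ν` at `E`, and `f` is the image under `p ^ n`
  -- of the cell error `u`.
  let f : X → ℝ := fun x => ((p ^ (n + l)) x).real E - ∑ i, ((p ^ n) x).real (c ⁻¹' {i}) * r i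
  have hfm : Measurable f := (hmeas (n + l) E hE).sub
    (Finset.measurable_sum _ fun i _ => (hmeas n _ (hc i)).mul_const _)
  have hfu : ∀ x, f x = ∫ y, u y ∂((p ^ n) x) := fun x => by
    rw [integral_sub (hint l E _ hE) (hrint _), ← real_pow_add_eq_integral p n l x hE,
      integral_eq_sum_fiber hc (hrint _)]
    change _ - _ = _ - _
    congr 1
    refine Finset.sum_congr rfl fun i _ => ?_
    rw [setIntegral_congr_fun (hc i) (g := fun _ => r i) fun y hy => by
      have : c y = i := hy
      simp only [this]]
    simp
  have hS : MeasurableSet {y | 1 / 32 ≤ |u y|} := measurableSet_le measurable_const hum.abs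
  have hSm : m.real {y | 1 / 32 ≤ |u y|} < δ := by
    have h3 := mul_meas_ge_le_integral_of_nonneg (μ := m) (f := fun y => |u y|)
      (Eventually.of_forall fun y => abs_nonneg _) (huint m).abs (1 / 32)
    have h4 := hl E hE
    simp only [← hw _ E hE] at h4
    change ∫ x, |u x| ∂m < δ / 32 at h4
    linarith
  -- Here L¹ smallness becomes uniform: off a set of `m`-measure below `δ` the error is at most `1 /
  -- 32`, and `p ^ n` gives that set mass at most `1 / 32` from every `x`.
  have hf : ∀ x, |f x| ≤ 1 / 16 := fun x => by
    rw [hfu]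
    have h3 := integral_le_add_of_le_off (m := (p ^ n) x) hum.abs (fun y => abs_nonneg _) hu1 hS
      (a := 1 / 32) (fun y hy => (not_le.1 hy).le) (by norm_num)
    have h4 := hac _ hS hSm x
    refine abs_integral_le_integral_abs.trans ?_
    linarith
  have key : ∀ (a : Measure X) [IsFiniteMeasure a], (markovOp p ^ (n + l)) (ofMeasure a) E -
      ∑ i, (markovOp p ^ n) (ofMeasure a) (c ⁻¹' {i}) * r i = integral (ofMeasure a) f := by
    intro a _
    rw [integral_ofMeasure a hfm hf, markovOp_pow_ofMeasure_apply p _ a hE,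
      integral_sub (hint _ E a hE)
        (integrable_finsetSum _ fun i _ => (hint n _ a (hc i)).mul_const _),
      integral_finsetSum _ fun i _ => (hint n _ a (hc i)).mul_const _]
    congr 1
    refine Finset.sum_congr rfl fun i _ => ?_
    rw [markovOp_pow_ofMeasure_apply p _ a (hc i), integral_mul_const]
  have hfinal : (((markovOpCa p ^ (n + l) - B) ν : ca X) : Ba X) E = integral (ν : Ba X) f := by
    have h3 : (((markovOpCa p ^ (n + l) - B) ν : ca X) : Ba X) E =
        (markovOp p ^ (n + l)) (ν : Ba X) E - (B ν : Ba X) E := by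
      rw [← coe_markovOpCa_pow]
      rfl
    rw [h3, hB]
    -- The identity `key` needs Lebesgue integrals, hence positive measures; the Jordan
    -- decomposition and linearity give it for signed `ν`.
    obtain ⟨a, b, _, _, hab⟩ := exists_eq_sub_ofMeasure ν.2
    rw [hab, integral_sub_left _ _ hfm hf, ← key a, ← key b, map_sub, map_sub]
    simp only [Ba.sub_apply, sub_mul, Finset.sum_sub_distrib]
    ring
  change |(((markovOpCa p ^ (n + l) - B) ν : ca X) : Ba X) E| ≤ _
  rw [hfinal]
  exact abs_integral_le (ν : Ba X) hfm hf

theorem quasicompactCondition_of_exists_pow_le {m : Measure X} [IsProbabilityMeasure m]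
    (h : ∀ η > 0, ∃ δ > 0, ∃ n ≥ 1, ∀ E, MeasurableSet E → m.real E < δ →
      ∀ x, ((p ^ n) x).real E ≤ η) : QuasicompactCondition p := by
  obtain ⟨δ, hδ, n, hn, hac⟩ := h (1 / 32) (by norm_num)
  -- The partition lemma multiplies the error by 4 and averaging by 2, giving `δ / 64 < δ / 32`. The
  -- power `l` is chosen after `n`, since its accuracy depends on `δ`.
  have hη : 0 < δ / 512 := by positivity
  obtain ⟨δ', hδ', l, -, hl⟩ := h (δ / 512) hη
  obtain ⟨ι, _, c, hc, hpart⟩ := exists_partition_integral_le (m := m) (p ^ l) hη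
    fun E hE hE0 x => hl E hE (by simpa [Measure.real, hE0] using hδ') x
  refine quasicompactCondition_of_partition (l := l) p hn hac hc fun E hE => ?_
  obtain ⟨a, ha⟩ := hpart E hE
  have h1 := integral_abs_sub_average_le (m := m) hc
    (Integrable.of_bound (measurable_measureReal (p ^ l) hE).aestronglyMeasurable 1
      (Eventually.of_forall fun x => abs_measureReal_le_one (p ^ l) E x)) a
  linarith

end Quasicompact

end MarkovCharge

theorem theorem5p3 {X : Type*} [MeasurableSpace X] (p : Kernel X X) [IsMarkovKernel p]
    (hdim : MarkovCharge.linDim (MarkovCharge.invBa p) = 1) :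
    MarkovCharge.DoeblinCondition p ∧ MarkovCharge.AveragedDoeblinCondition p ∧
      MarkovCharge.QuasicompactCondition p ∧
      (∃ μ ∈ MarkovCharge.ca X, MarkovCharge.invBa p = {μ} ∧ MarkovCharge.invCa p = {μ}) ∧
      (∀ μ ∈ MarkovCharge.invBa p, μ ∈ MarkovCharge.ca X) := by
  obtain ⟨m, _, hm, hinv, hunif⟩ := MarkovCharge.exists_invariant_measure p hdim
  have hca := MarkovCharge.ofMeasure_mem_ca m
  have hpow := fun η (hη : (0 : ℝ) < η) => MarkovCharge.exists_pow_le p hinv hunif hη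
  refine ⟨MarkovCharge.doeblinCondition_of_exists_pow_le p (hpow _ (by norm_num)),
    MarkovCharge.averagedDoeblinCondition_of_exists_cesaroTransition_le p
      (MarkovCharge.exists_cesaroTransition_le p hunif (by norm_num)),
    MarkovCharge.quasicompactCondition_of_exists_pow_le p hpow,
    ⟨_, hca, hm, ?_⟩, fun μ hμ => ?_⟩
  · have h : MarkovCharge.invCa p = (MarkovCharge.ca X : Set (MarkovCharge.Ba X)) ∩ MarkovCharge.invBa p := rfl
    rw [h, hm, Set.inter_eq_right, Set.singleton_subset_iff]
    exact hca
  · rw [hm, Set.mem_singleton_iff] at hμ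
    exact hμ ▸ hca
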